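/- An input-driven pushdown automaton with translucent input letters (NIDPDAwtl) is a system $M=\langle Q,\Sigma,\Gamma,q_0,\vartriangleleft,\bot,\tau,\delta_D,\delta_R,\delta_N\rangle$ with finite sets $Q$ of states and $\Gamma$ of pushdown symbols, a finite input alphabet $\Sigma$ partitioned into $\Sigma_D$ (letters that push one symbol), $\Sigma_R$ (letters that pop one symbol, where popping from the empty pushdown leaves it empty) and $\Sigma_N$ (letters that leave the pushdown unchanged), an initial state $q_0\in Q$, an endmarker $\vartriangleleft\notin\Sigma$, a bottom symbol $\bot\notin\Gamma$, a translucency mapping $\tau:Q\to 2^\Sigma$, and partial transition functions $\delta_D:Q\times\Sigma_D\times(\Gamma\cup\{\bot\})\to 2^{Q\times\Gamma}\cup\{\mathtt{accept}\}$, $\delta_R:Q\times\Sigma_R\times(\Gamma\cup\{\bot\})\to 2^{Q}\cup\{\mathtt{accept}\}$ and $\delta_N:Q\times(\Sigma_N\cup\{\vartriangleleft\})\times(\Gamma\cup\{\bot\})\to 2^{Q}\cup\{\mathtt{accept}\}$. The computation starts in $q_0$ with empty pushdown and the head at the left end of the input. In state $q$ the automaton skips the letters of $\tau(q)$, processes the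 first letter $a\notin\tau(q)$ to the right of the head and deletes it; if there is no such letter it processes the endmarker, which is not deleted. The transition applied depends on the state, the processed symbol and the topmost pushdown symbol ($\bot$ if the pushdown is empty). In the returning mode the head goes back to the left end of the remaining input after every step. In the non-returning mode the head stays at the position of the letter just processed, and goes back to the left end of the remaining input only after processing the endmarker. A word is accepted if some computation on it reaches $\mathtt{accept}$. The automaton is deterministic if every value of a transition function, on the endmarker too, is undefined, $\mathtt{accept}$, or a set with at most one element. Deterministic automata are called DIDPDAwtl in the returning mode and nrDIDPDAwtl in the non-returning mode. The partition $(\Sigma_D,\Sigma_R,\Sigma_N)$ is the signature of the automaton, and $\mathscr{L}(\mathsf{X})$ is the family of languages accepted by automata of type $\mathsf{X}$. Proposition. Over the alphabet $\{a,b,\#\}$, let $L_1$ be the set of all interleavings (shuffles) of a word $b^n\#b^m$ with $a^n$, and $L_2$ the set of all interleavings of a word $b^m\#b^n$ with $a^n$, where $m,n\ge 1$. Then $L_1$ and $L_2$ are each accepted by a DIDPDAwtl with signature $\Sigma_D=\{a\}$, $\Sigma_R=\{b\}$, $\Sigma_N=\{\#\}$, but $L_1\cup L_2$ is not accepted by any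 nrDIDPDAwtl, whatever its signature. The families $\mathscr{L}(\mathsf{nrDIDPDAwtl})$ and $\mathscr{L}(\mathsf{DIDPDAwtl})$ are closed neither under union nor under intersection, and this holds even for automata with identical signatures: for each of the two families and each of the two operations there are two languages accepted by automata of the respective type with one and the same signature, such that the result of the operation is not accepted by any automaton of this type with any signature. -/

import Mathlib

namespace TranslucentPDA

/-- The three kinds of input letters of an input-driven pushdown automaton: letters in `Σ_D` push,
letters in `Σ_R` pop, letters in `Σ_N` leave the pushdown store unchanged. -/
inductive Kind where
  | push
  | pop
  | neutral

/-- A signature of an alphabet `A`: its partition into `Σ_D`, `Σ_R` and `Σ_N`. -/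
abbrev Signature (A : Type) : Type := A → Kind

/-- A value of a transition function: a set of possible results or `accept`.
An undefined transition is the same thing as `goto ∅`. -/
inductive Outcome (α : Type) where
  | goto (S : Set α)
  | accept

/-- At most one result; the single value `accept` is also allowed. -/
def Outcome.AtMostOne {α : Type} : Outcome α → Prop
  | .goto S => S.encard ≤ 1
  | .accept => True

/-- An input-driven pushdown automaton with translucent input letters over the alphabet `A`.
In `Option Stack` the value `none` stands for the bottom-of-pushdown symbol `⊥`; in `Option A`
(first letter argument of `δN`) the value `none` stands for the endmarker.
The values of `δD`, `δR`, `δN` at letters that are not of the corresponding kind are never used. -/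
structure NIDPDAwtl (A : Type) where
  /-- internal states -/
  State : Type
  /-- pushdown symbols -/
  Stack : Type
  finiteState : Finite State
  finiteStack : Finite Stack
  /-- the partition of the input alphabet -/
  sig : Signature A
  /-- initial state -/
  start : State
  /-- translucency mapping: `τ q` is the set of letters that are invisible in state `q` -/
  τ : State → Set A
  δD : State → A → Option Stack → Outcome (State × Stack)
  δR : State → A → Option Stack → Outcome State
  δN : State → Option A → Option Stack → Outcome State

namespace NIDPDAwtl

variable {A : Type} (M : NIDPDAwtl A)

/-- `M` is deterministic: in every situation, on input letters as well as on the endmarker,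
there is at most one possible move. -/
def IsDeterministic : Prop :=
  (∀ q a z, M.sig a = .push → (M.δD q a z).AtMostOne) ∧
  (∀ q a z, M.sig a = .pop → (M.δR q a z).AtMostOne) ∧
  (∀ q a z, M.sig a = .neutral → (M.δN q (some a) z).AtMostOne) ∧
  (∀ q z, (M.δN q none z).AtMostOne)

/-- Processing the input letter `a` in state `q` with pushdown content `γ` (top symbol first,
without the bottom symbol) can lead to state `q'` and pushdown content `γ'`.
Popping from the empty pushdown store leaves it empty. -/
inductive Processes : M.State → A → List M.Stack → M.State → List M.Stack → Prop
  | push {q a γ q' z' S} (ha : M.sig a = .push) (hS : M.δD q a γ.head? = .goto S)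
      (h : (q', z') ∈ S) : Processes q a γ q' (z' :: γ)
  | pop {q a γ q' S} (ha : M.sig a = .pop) (hS : M.δR q a γ.head? = .goto S)
      (h : q' ∈ S) : Processes q a γ q' γ.tail
  | neutral {q a γ q' S} (ha : M.sig a = .neutral) (hS : M.δN q (some a) γ.head? = .goto S)
      (h : q' ∈ S) : Processes q a γ q' γ

/-- Processing the input letter `a` in state `q` with pushdown content `γ` yields `accept`. -/
inductive LetterAccepts : M.State → A → List M.Stack → Prop
  | push {q a γ} (ha : M.sig a = .push) (h : M.δD q a γ.head? = .accept) : LetterAccepts q a γ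
  | pop {q a γ} (ha : M.sig a = .pop) (h : M.δR q a γ.head? = .accept) : LetterAccepts q a γ
  | neutral {q a γ} (ha : M.sig a = .neutral) (h : M.δN q (some a) γ.head? = .accept) :
      LetterAccepts q a γ

/-- Configurations in the returning mode: state, remaining input, pushdown content;
or `accept`. -/
inductive Config where
  | run (q : M.State) (w : List A) (γ : List M.Stack)
  | accept

/-- One step in the returning mode: the first visible letter `a` is processed and deleted and the
head returns to the left end; if all remaining letters are invisible, the endmarker is
processed. -/
inductive Step : M.Config → M.Config → Prop
  | letter {q x a y γ q' γ'} (hx : ∀ c ∈ x, c ∈ M.τ q) (ha : a ∉ M.τ q)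
      (h : M.Processes q a γ q' γ') : Step (.run q (x ++ a :: y) γ) (.run q' (x ++ y) γ')
  | letterAccept {q x a y γ} (hx : ∀ c ∈ x, c ∈ M.τ q) (ha : a ∉ M.τ q)
      (h : M.LetterAccepts q a γ) : Step (.run q (x ++ a :: y) γ) .accept
  | endmarker {q x γ q' S} (hx : ∀ c ∈ x, c ∈ M.τ q) (hS : M.δN q none γ.head? = .goto S)
      (h : q' ∈ S) : Step (.run q x γ) (.run q' x γ)
  | endmarkerAccept {q x γ} (hx : ∀ c ∈ x, c ∈ M.τ q) (h : M.δN q none γ.head? = .accept) :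
      Step (.run q x γ) .accept

/-- The language accepted by `M` in the returning mode. -/
def language : Language A :=
  {w | Relation.ReflTransGen M.Step (.run M.start w []) .accept}

/-- Configurations in the non-returning mode: remaining input `u` to the left of the head, state,
remaining input `w` to the right of the head, pushdown content; or `accept`. -/
inductive NRConfig where
  | run (u : List A) (q : M.State) (w : List A) (γ : List M.Stack)
  | accept

/-- One step in the non-returning mode: after a letter is processed the head stays where that
letter was; only a move on the endmarker brings the head back to the left end. -/
inductive NRStep : M.NRConfig → M.NRConfig → Prop
  | letter {u q x a y γ q' γ'} (hx : ∀ c ∈ x, c ∈ M.τ q) (ha : a ∉ M.τ q)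
      (h : M.Processes q a γ q' γ') : NRStep (.run u q (x ++ a :: y) γ) (.run (u ++ x) q' y γ')
  | letterAccept {u q x a y γ} (hx : ∀ c ∈ x, c ∈ M.τ q) (ha : a ∉ M.τ q)
      (h : M.LetterAccepts q a γ) : NRStep (.run u q (x ++ a :: y) γ) .accept
  | endmarker {u q x γ q' S} (hx : ∀ c ∈ x, c ∈ M.τ q) (hS : M.δN q none γ.head? = .goto S)
      (h : q' ∈ S) : NRStep (.run u q x γ) (.run [] q' (u ++ x) γ)
  | endmarkerAccept {u q x γ} (hx : ∀ c ∈ x, c ∈ M.τ q) (h : M.δN q none γ.head? = .accept) :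
      NRStep (.run u q x γ) .accept

/-- The language accepted by `M` in the non-returning mode. -/
def nrLanguage : Language A :=
  {w | Relation.ReflTransGen M.NRStep (.run [] M.start w []) .accept}

end NIDPDAwtl

/-- The languages accepted by a DIDPDAwtl (deterministic, returning mode) with signature `s`. -/
def DIDPDAwtl (A : Type) (s : Signature A) : Set (Language A) :=
  {L | ∃ M : NIDPDAwtl A, M.IsDeterministic ∧ M.sig = s ∧ M.language = L}

/-- The languages accepted by an nrDIDPDAwtl (deterministic, non-returning mode) with
signature `s`. -/
def nrDIDPDAwtl (A : Type) (s : Signature A) : Set (Language A) :=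
  {L | ∃ M : NIDPDAwtl A, M.IsDeterministic ∧ M.sig = s ∧ M.nrLanguage = L}

/-- The family `F` (all alphabets, all signatures) is closed under the binary operation `op`. -/
def ClosedUnder (F : (A : Type) → Signature A → Set (Language A))
    (op : (A : Type) → Language A → Language A → Language A) : Prop :=
  ∀ (A : Type) [Finite A] (L₁ L₂ : Language A),
    (∃ s, L₁ ∈ F A s) → (∃ s, L₂ ∈ F A s) → ∃ s, op A L₁ L₂ ∈ F A s

/-- Applying `op` to two languages of `F` that belong to one and the same signature gives a
language of `F` (for some signature, which may be a different one). -/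
def ClosedUnderOnSameSignature (F : (A : Type) → Signature A → Set (Language A))
    (op : (A : Type) → Language A → Language A → Language A) : Prop :=
  ∀ (A : Type) [Finite A] (s : Signature A) (L₁ L₂ : Language A),
    L₁ ∈ F A s → L₂ ∈ F A s → ∃ s', op A L₁ L₂ ∈ F A s'

/-- Union of languages. -/
def unionOp (A : Type) (L₁ L₂ : Language A) : Language A := {w | w ∈ L₁ ∨ w ∈ L₂}

/-- Intersection of languages. -/
def interOp (A : Type) (L₁ L₂ : Language A) : Language A := {w | w ∈ L₁ ∧ w ∈ L₂}

/-- `Shuffle u v w`: the word `w` is an interleaving of `u` and `v`. -/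
inductive Shuffle {A : Type} : List A → List A → List A → Prop
  | nil : Shuffle [] [] []
  | left {c u v w} (h : Shuffle u v w) : Shuffle (c :: u) v (c :: w)
  | right {c u v w} (h : Shuffle u v w) : Shuffle u (c :: v) (c :: w)

/-- The alphabet `{a, b, #}`. -/
inductive Letter where
  | a
  | b
  | hash

/-- The signature `Σ_D = {a}`, `Σ_R = {b}`, `Σ_N = {#}`. -/
def Letter.sig : Signature Letter
  | .a => .push
  | .b => .pop
  | .hash => .neutral

/-- All interleavings of `bⁿ # bᵐ` with `aⁿ`, for `m, n ≥ 1`. -/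
def langL1 : Language Letter :=
  {w | ∃ m n : ℕ, 1 ≤ m ∧ 1 ≤ n ∧
    Shuffle (List.replicate n .b ++ .hash :: List.replicate m .b) (List.replicate n .a) w}

/-- All interleavings of `bᵐ # bⁿ` with `aⁿ`, for `m, n ≥ 1`. -/
def langL2 : Language Letter :=
  {w | ∃ m n : ℕ, 1 ≤ m ∧ 1 ≤ n ∧
    Shuffle (List.replicate m .b ++ .hash :: List.replicate n .b) (List.replicate n .a) w}

end TranslucentPDA

/-! The positive half is given by two explicit returning automata. For the negative half it suffices
to look at words `aⁿ bⁱ # bʲ` with `n, i, j ≥ 1`: the union contains such a word iff `n = i` or `n =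
j`, the intersection iff `n = i = j`. No deterministic non-returning automaton makes either
distinction (`IsDeterministic.not_or`, `IsDeterministic.not_and`). A non-returning automaton can
simulate the returning mode with the same signature, so both families are covered at once.

On such words the head always stands at the beginning of a block, because the letter that is deleted
is the first one of its block. So the automaton is an ordinary pushdown system whose finite control
holds the state, the head's block and the set of empty blocks, and each step has as weight the
vector of letters it deletes. The run is followed until no further letter will be deleted, except in
an accepting step (`exists_idle`). From there the answer depends only on the control state and the
topmost pushdown symbol, not on the lengths of the nonempty blocks (`accept_of_idle`).

If few `a`'s have been deleted by then, some are left over, and adding more changes nothing.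
Otherwise the run has a repetition `kv`, `kx` as in the pumping lemma for context-free languages
(`Run.pumping`), both parts being closed paths in the control. A closed path deletes no `#` and
touches at most one of the two `b`-blocks, since the second block can be reached over a nonempty
first one only by deleting `#` (`closed_path`). If `kx` is empty, only one `b`-block is pumped. If
not, `kv` raises the pushdown and `kx` lowers it by the same amount. The signature fixes the effect
of each letter, so one of `a`, `b` pushes, the other pops, and equally many `a`'s and `b`'s are
pumped.

Thus the pumped vector `δ` has `δ 0 ≥ 1` and satisfies `δ 1 = 0`, `δ 3 = 0` or `δ 0 = δ 1 + δ 3`.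
Each alternative contradicts both conditions on `n, i, j`; for the disjunction this uses the usual
factorial trick. -/

namespace TranslucentPDA

/-! ### Weighted pushdown systems: runs, derivations, contexts -/

/-- The effect of a step of a pushdown system on the pushdown store. -/
inductive StackOp (Γ : Type) where
  | push (s : Γ)
  | pop
  | keep

namespace StackOp

variable {Γ : Type}

/-- The pushdown content after the operation. -/
def apply : StackOp Γ → List Γ → List Γ
  | push s, γ => s :: γ
  | pop, γ => γ.tail
  | keep, γ => γ

/-- The change of the height of a nonempty pushdown store. -/
def shift : StackOp Γ → ℤ
  | push _ => 1
  | pop => -1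
  | keep => 0

end StackOp

/-- A pushdown system whose transitions carry weights in `W`. -/
abbrev PushdownSystem (X Γ W : Type) : Type := X → Option Γ → W → StackOp Γ → X → Prop

namespace PushdownSystem

variable {X Γ W : Type} [AddCommMonoid W] (T : PushdownSystem X Γ W)

/-- Runs, with the sum of the weights of the steps. -/
inductive Run : X → List Γ → W → X → List Γ → Prop
  | refl (p γ) : Run p γ 0 p γ
  | step {p γ k op p' k' p'' γ''} (h : T p γ.head? k op p')
      (hr : Run p' (op.apply γ) k' p'' γ'') : Run p γ (k + k') p'' γ''

/-- Paths in the control graph, ignoring the pushdown store. -/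
inductive Path : X → W → X → Prop
  | refl (p) : Path p 0 p
  | step {p z k op p' k' p''} (h : T p z k op p') (hr : Path p' k' p'') : Path p (k + k') p''

/-- `Deriv T F (p, z, some p') k`: a run from `p` to `p'` that starts and ends with the same
store, with top symbol `z`, and never goes below it. `Deriv T F (p, z, none) k`: a run from `p`
with top symbol `z` that never goes below it and ends in a situation satisfying `F`. -/
inductive Deriv (F : X → Option Γ → Prop) : X × Option Γ × Option X → W → Prop
  | nil (p z) : Deriv F (p, z, some p) 0
  | final {p z} (h : F p z) : Deriv F (p, z, none) 0
  | keep {p z k p' o k'} (h : T p z k .keep p') (hd : Deriv F (p', z, o) k') :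
      Deriv F (p, z, o) (k + k')
  | popEmpty {p k p' o k'} (h : T p none k .pop p') (hd : Deriv F (p', none, o) k') :
      Deriv F (p, none, o) (k + k')
  | call {p z k s p₁ k₁ p₂ k₂ p₃ o k₃} (h : T p z k (.push s) p₁)
      (hd₁ : Deriv F (p₁, some s, some p₂) k₁) (h₂ : T p₂ (some s) k₂ .pop p₃)
      (hd₃ : Deriv F (p₃, z, o) k₃) : Deriv F (p, z, o) (k + k₁ + k₂ + k₃)
  | pend {p z k s p₁ k₁} (h : T p z k (.push s) p₁) (hd : Deriv F (p₁, some s, none) k₁) :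
      Deriv F (p, z, none) (k + k₁)

/-- `Ctx T F Y Z kv kx`: a derivation of `Y` with a hole of type `Z`; the weights `kv` and `kx`
are those of the parts before and after the hole. -/
inductive Ctx (F : X → Option Γ → Prop) :
    X × Option Γ × Option X → X × Option Γ × Option X → W → W → Prop
  | refl (Y) : Ctx F Y Y 0 0
  | keep {p z k p' o Y kv kx} (h : T p z k .keep p') (hc : Ctx F (p', z, o) Y kv kx) :
      Ctx F (p, z, o) Y (k + kv) kx
  | popEmpty {p k p' o Y kv kx} (h : T p none k .pop p') (hc : Ctx F (p', none, o) Y kv kx) :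
      Ctx F (p, none, o) Y (k + kv) kx
  | callTail {p z k s p₁ k₁ p₂ k₂ p₃ o Y kv kx} (h : T p z k (.push s) p₁)
      (hd₁ : Deriv T F (p₁, some s, some p₂) k₁) (h₂ : T p₂ (some s) k₂ .pop p₃)
      (hc : Ctx F (p₃, z, o) Y kv kx) : Ctx F (p, z, o) Y (k + k₁ + k₂ + kv) kx
  | callBody {p z k s p₁ p₂ k₂ p₃ o k₃ Y kv kx} (h : T p z k (.push s) p₁)
      (hc : Ctx F (p₁, some s, some p₂) Y kv kx) (h₂ : T p₂ (some s) k₂ .pop p₃)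
      (hd₃ : Deriv T F (p₃, z, o) k₃) : Ctx F (p, z, o) Y (k + kv) (kx + (k₂ + k₃))
  | pend {p z k s p₁ Y kv kx} (h : T p z k (.push s) p₁)
      (hc : Ctx F (p₁, some s, none) Y kv kx) : Ctx F (p, z, none) Y (k + kv) kx

variable {T} {F : X → Option Γ → Prop}

theorem Run.trans {p γ k p' γ' k' p'' γ''} (h : Run T p γ k p' γ') (h' : Run T p' γ' k' p'' γ'') :
    Run T p γ (k + k') p'' γ'' := by
  induction h with
  | refl => simpa using h'
  | step h _ ih => rw [add_assoc]; exact .step h (ih h')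

theorem Path.trans {p k p' k' p''} (h : Path T p k p') (h' : Path T p' k' p'') :
    Path T p (k + k') p'' := by
  induction h with
  | refl => simpa using h'
  | step h _ ih => rw [add_assoc]; exact .step h (ih h')

theorem Path.single {p z k op p'} (h : T p z k op p') : Path T p k p' := by
  simpa using Path.step h (.refl p')

theorem Ctx.trans {Y Y' Y'' kv kx kv' kx'} (h : Ctx T F Y Y' kv kx) (h' : Ctx T F Y' Y'' kv' kx') :
    Ctx T F Y Y'' (kv + kv') (kx' + kx) := by
  induction h with
  | refl => simpa using h'
  | keep h _ ih => rw [add_assoc]; exact .keep h (ih h')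
  | popEmpty h _ ih => rw [add_assoc]; exact .popEmpty h (ih h')
  | callTail h hd h₂ _ ih => rw [add_assoc]; exact .callTail h hd h₂ (ih h')
  | callBody h _ h₂ hd ih => rw [add_assoc, ← add_assoc kx']; exact .callBody h (ih h') h₂ hd
  | pend h _ ih => rw [add_assoc]; exact .pend h (ih h')

theorem Ctx.iterate {Y kv kx} (h : Ctx T F Y Y kv kx) (n : ℕ) :
    Ctx T F Y Y (n • kv) (n • kx) := by
  induction n with
  | zero => simpa using Ctx.refl Y
  | succ n ih => rw [succ_nsmul, succ_nsmul']; exact ih.trans h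

theorem Ctx.plug {Y Z kv kx k} (h : Ctx T F Y Z kv kx) (hd : Deriv T F Z k) :
    Deriv T F Y (kv + k + kx) := by
  induction h with
  | refl => simpa using hd
  | keep h _ ih => convert Deriv.keep h (ih hd) using 1; abel
  | popEmpty h _ ih => convert Deriv.popEmpty h (ih hd) using 1; abel
  | callTail h hd₁ h₂ _ ih => convert Deriv.call h hd₁ h₂ (ih hd) using 1; abel
  | callBody h _ h₂ hd₃ ih => convert Deriv.call h (ih hd) h₂ hd₃ using 1; abel
  | pend h _ ih => convert Deriv.pend h (ih hd) using 1; abel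

/-! ### Repetitions in derivations -/

/-- A derivation with at least one mark has a subderivation with about half of the marks such
that at least one mark lies outside. -/
theorem Deriv.split (μ : W →+ ℕ) (hμ : ∀ p z k op p', T p z k op p' → μ k ≤ 1) {Y k}
    (hd : Deriv T F Y k) (hk : 1 ≤ μ k) :
    ∃ Z kv kx k₁, Ctx T F Y Z kv kx ∧ Deriv T F Z k₁ ∧ k = kv + k₁ + kx ∧ 1 ≤ μ (kv + kx) ∧
      μ k ≤ 2 * μ k₁ + 2 := by
  induction hd with
  | nil => simp at hk
  | final => simp at hk
  | @keep p z k p' o k' h hd ih =>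
    have := hμ _ _ _ _ _ h
    simp only [map_add] at hk ⊢
    by_cases h0 : μ k = 0
    · obtain ⟨Z, kv, kx, k₁, hc, hd', rfl, h1, h2⟩ := ih (by omega)
      exact ⟨Z, _, _, k₁, .keep h hc, hd', by abel, by simp at *; omega, by simp at *; omega⟩
    · exact ⟨_, _, _, k', .keep h (.refl _), hd, by abel, by simp; omega, by omega⟩
  | @popEmpty p k p' o k' h hd ih =>
    have := hμ _ _ _ _ _ h
    simp only [map_add] at hk ⊢
    by_cases h0 : μ k = 0
    · obtain ⟨Z, kv, kx, k₁, hc, hd', rfl, h1, h2⟩ := ih (by omega)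
      exact ⟨Z, _, _, k₁, .popEmpty h hc, hd', by abel, by simp at *; omega, by simp at *; omega⟩
    · exact ⟨_, _, _, k', .popEmpty h (.refl _), hd, by abel, by simp; omega, by omega⟩
  | @pend p z k s p₁ k' h hd ih =>
    have := hμ _ _ _ _ _ h
    simp only [map_add] at hk ⊢
    by_cases h0 : μ k = 0
    · obtain ⟨Z, kv, kx, k₁, hc, hd', rfl, h1, h2⟩ := ih (by omega)
      exact ⟨Z, _, _, k₁, .pend h hc, hd', by abel, by simp at *; omega, by simp at *; omega⟩
    · exact ⟨_, _, _, k', .pend h (.refl _), hd, by abel, by simp; omega, by omega⟩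
  | @call p z k s p₁ k₁ p₂ k₂ p₃ o k₃ h hd₁ h₂ hd₃ ih₁ ih₃ =>
    have := hμ _ _ _ _ _ h
    have := hμ _ _ _ _ _ h₂
    simp only [map_add] at hk ⊢
    -- The heavier of the two subderivations is kept, whence the factor 2. If no mark lies outside
    -- it, it has all the marks and the induction hypothesis loses nothing.
    by_cases hle : μ k₁ ≤ μ k₃
    · by_cases h0 : μ k + μ k₁ + μ k₂ = 0
      · obtain ⟨Z, kv, kx, k', hc, hd', rfl, h1, h2⟩ := ih₃ (by omega)
        exact ⟨Z, _, _, k', .callTail h hd₁ h₂ hc, hd', by abel, by simp at *; omega,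
          by simp at *; omega⟩
      · exact ⟨_, _, _, k₃, .callTail h hd₁ h₂ (.refl _), hd₃, by abel, by simp; omega, by omega⟩
    · by_cases h0 : μ k + μ k₂ + μ k₃ = 0
      · obtain ⟨Z, kv, kx, k', hc, hd', rfl, h1, h2⟩ := ih₁ (by omega)
        exact ⟨Z, _, _, k', .callBody h hc h₂ hd₃, hd', by abel, by simp at *; omega,
          by simp at *; omega⟩
      · exact ⟨_, _, _, k₁, .callBody h (.refl _) h₂ hd₃, hd₁, by abel, by simp; omega, by omega⟩

/-- The derivation `(Y, k)` contains a repetition that can be pumped and carries a mark. -/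
def Pumpable (T : PushdownSystem X Γ W) (F : X → Option Γ → Prop) (μ : W →+ ℕ)
    (Y : X × Option Γ × Option X) (k : W) : Prop :=
  ∃ Z kv kx kv' kx' k', Ctx T F Y Z kv kx ∧ Ctx T F Z Z kv' kx' ∧ Deriv T F Z k' ∧
    k = kv + (kv' + k' + kx') + kx ∧ 1 ≤ μ (kv' + kx')

/-- Pigeonhole along a branch that always follows a heavy subderivation. `A` collects the types
already met, and meeting one again is a repetition. Each `Deriv.split` at most halves `μ k + 2`, so
`2 ^ (n + 2)` leaves enough marks while at most `n` types are new. Each split leaves a mark outside,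
so the repetition carries one. -/
theorem Deriv.pumpable_or [Finite X] [Finite Γ] (μ : W →+ ℕ)
    (hμ : ∀ p z k op p', T p z k op p' → μ k ≤ 1) (n : ℕ) :
    ∀ (A : Set (X × Option Γ × Option X)), Aᶜ.ncard ≤ n → ∀ Y k, Deriv T F Y k →
      2 ^ (n + 2) ≤ μ k + 2 → Pumpable T F μ Y k ∨
      ∃ Z ∈ A, ∃ kv kx k', Ctx T F Y Z kv kx ∧ Deriv T F Z k' ∧ k = kv + k' + kx ∧
        1 ≤ μ (kv + kx) := by
  induction n with
  | zero =>
    intro A hA Y k hd hk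
    obtain ⟨Z, kv, kx, k₁, hc, hd₁, hk₁, h1, -⟩ := hd.split μ hμ (by omega)
    refine .inr ⟨Z, ?_, kv, kx, k₁, hc, hd₁, hk₁, h1⟩
    have : Aᶜ = ∅ := (Set.ncard_eq_zero (Set.toFinite _)).1 (by omega)
    simp_all
  | succ n ih =>
    intro A hA Y k hd hk
    have hpow : 2 ^ (n + 1 + 2) = 2 * 2 ^ (n + 2) := by ring
    have hpos : 4 ≤ 2 ^ (n + 2) := by
      calc 4 = 2 ^ 2 := rfl
        _ ≤ 2 ^ (n + 2) := Nat.pow_le_pow_right (by omega) (by omega)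
    obtain ⟨Z, kv, kx, k₁, hc, hd₁, rfl, h1, h2⟩ := hd.split μ hμ (by omega)
    by_cases hZ : Z ∈ A
    · exact .inr ⟨Z, hZ, kv, kx, k₁, hc, hd₁, rfl, h1⟩
    have hcard : (insert Z A)ᶜ.ncard ≤ n := by
      have : (insert Z A)ᶜ ⊂ Aᶜ := by
        refine ⟨by intro; simp +contextual, fun hsub => ?_⟩
        exact hsub hZ (Set.mem_insert Z A)
      have := Set.ncard_lt_ncard this (Set.toFinite _)
      omega
    rcases ih _ hcard Z k₁ hd₁ (by omega) with
      ⟨Z', kv₁, kx₁, kv', kx', k', hc₁, hc', hd', rfl, h3⟩ | ⟨Z', hZ', kv', kx', k', hc', hd', rfl, h3⟩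
    · exact .inl ⟨Z', _, _, kv', kx', k', hc.trans hc₁, hc', hd', by abel, h3⟩
    · rcases hZ' with rfl | hZ'
      · exact .inl ⟨Z', kv, kx, kv', kx', k', hc, hc', hd', rfl, h3⟩
      · refine .inr ⟨Z', hZ', _, _, k', hc.trans hc', hd', by abel, ?_⟩
        simp only [map_add] at *
        omega

theorem Deriv.pumpable [Finite X] [Finite Γ] (μ : W →+ ℕ)
    (hμ : ∀ p z k op p', T p z k op p' → μ k ≤ 1) {Y k} (hd : Deriv T F Y k)
    (hk : 2 ^ (Nat.card (X × Option Γ × Option X) + 2) ≤ μ k) : Pumpable T F μ Y k := by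
  rcases hd.pumpable_or μ hμ _ ∅ (by rw [Set.compl_empty, Set.ncard_univ]) Y k (by omega) with
    h | ⟨_, h, _⟩
  · exact h
  · exact h.elim

/-! ### Control paths and height changes of contexts -/

theorem Deriv.path {Y k} (hd : Deriv T F Y k) : ∀ q, Y.2.2 = some q → Path T Y.1 k q := by
  induction hd with
  | nil => rintro q ⟨⟩; exact .refl _
  | final => rintro q ⟨⟩
  | keep h _ ih => exact fun q hq => .step h (ih q hq)
  | popEmpty h _ ih => exact fun q hq => .step h (ih q hq)
  | call h _ h₂ _ ih₁ ih₃ =>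
    exact fun q hq => (((Path.single h).trans (ih₁ _ rfl)).trans (.single h₂)).trans (ih₃ q hq)
  | pend => rintro q ⟨⟩

theorem Ctx.path_left {Y Z kv kx} (hc : Ctx T F Y Z kv kx) : Path T Y.1 kv Z.1 := by
  induction hc with
  | refl => exact .refl _
  | keep h _ ih => exact .step h ih
  | popEmpty h _ ih => exact .step h ih
  | callTail h hd h₂ _ ih =>
    exact (((Path.single h).trans (hd.path _ rfl)).trans (.single h₂)).trans ih
  | callBody h _ _ _ ih => exact .step h ih
  | pend h _ ih => exact .step h ih

theorem Ctx.path_right {Y Z kv kx} (hc : Ctx T F Y Z kv kx) :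
    ∀ q q', Y.2.2 = some q → Z.2.2 = some q' → Path T q' kx q := by
  induction hc with
  | refl => intro q q' h h'; rw [h] at h'; cases h'; exact .refl _
  | keep _ _ ih => exact ih
  | popEmpty _ _ ih => exact ih
  | callTail _ _ _ _ ih => exact ih
  | callBody _ _ h₂ hd₃ ih =>
    exact fun q q' hq hq' => (ih _ q' rfl hq').trans (.step h₂ (hd₃.path q hq))
  | pend => rintro q q' ⟨⟩

theorem Ctx.isSome_top {Y Z kv kx} (hc : Ctx T F Y Z kv kx) :
    Y.2.1.isSome → Z.2.1.isSome := by
  induction hc <;> simp_all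

theorem Ctx.isSome_target {Y Z kv kx} (hc : Ctx T F Y Z kv kx) :
    Y.2.2.isSome → Z.2.2.isSome := by
  induction hc <;> simp_all

/-- Only `callBody` leaves anything after the hole, and below it the store is nonempty and the
target is fixed. -/
theorem Ctx.right_eq_zero {Y Z kv kx} (hc : Ctx T F Y Z kv kx)
    (h : Z.2.1 = none ∨ Z.2.2 = none) : kx = 0 := by
  induction hc with
  | refl => rfl
  | keep _ _ ih => exact ih h
  | popEmpty _ _ ih => exact ih h
  | callTail _ _ _ _ ih => exact ih h
  | callBody _ hc =>
    have h1 := hc.isSome_top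
    have h2 := hc.isSome_target
    rcases h with h | h <;> simp [h] at h1 h2
  | pend _ _ ih => exact ih h

section Shift

variable {w : W →+ ℤ} (hw : ∀ p z k op p', T p z k op p' → w k = op.shift)
include hw

/-- The assumption of a nonempty store excludes `popEmpty`, the one step whose `shift` is not its
true height change. -/
theorem Deriv.balanced {Y k} (hd : Deriv T F Y k) :
    Y.2.1.isSome → Y.2.2.isSome → w k = 0 := by
  induction hd with
  | nil => simp
  | final => simp
  | keep h _ ih => simpa [hw _ _ _ _ _ h, StackOp.shift] using ih
  | popEmpty => simp
  | call h _ h₂ _ ih₁ ih₃ =>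
    intro hz ho
    simp [hw _ _ _ _ _ h, hw _ _ _ _ _ h₂, StackOp.shift, ih₁ rfl rfl, ih₃ hz ho]
  | pend => simp

theorem Ctx.balanced {Y Z kv kx} (hc : Ctx T F Y Z kv kx) :
    Y.2.1.isSome → Y.2.2.isSome → w kv + w kx = 0 := by
  induction hc with
  | refl => simp
  | keep h _ ih => simpa [hw _ _ _ _ _ h, StackOp.shift] using ih
  | popEmpty => simp
  | callTail h hd h₂ _ ih =>
    simpa [hw _ _ _ _ _ h, hw _ _ _ _ _ h₂, StackOp.shift, hd.balanced hw rfl rfl] using ih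
  | callBody h _ h₂ hd ih =>
    intro hz ho
    have := ih rfl rfl
    simp [hw _ _ _ _ _ h, hw _ _ _ _ _ h₂, StackOp.shift, hd.balanced hw hz ho]
    omega
  | pend => simp

/-- Before the hole, completed calls are balanced and unfinished ones add 1 each. A nonempty right
part needs at least one unfinished call. -/
theorem Ctx.shift_left {Y Z kv kx} (hc : Ctx T F Y Z kv kx) :
    Y.2.1.isSome → 0 ≤ w kv ∧ (kx = 0 ∨ 1 ≤ w kv) := by
  induction hc with
  | refl => simp
  | keep h _ ih => simpa [hw _ _ _ _ _ h, StackOp.shift] using ih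
  | popEmpty => simp
  | callTail h hd h₂ _ ih =>
    simpa [hw _ _ _ _ _ h, hw _ _ _ _ _ h₂, StackOp.shift, hd.balanced hw rfl rfl] using ih
  | callBody h _ _ _ ih =>
    intro _
    have := ih rfl
    simp only [map_add, hw _ _ _ _ _ h, StackOp.shift]
    omega
  | pend h _ ih =>
    intro _
    have := ih rfl
    simp only [map_add, hw _ _ _ _ _ h, StackOp.shift]
    omega

end Shift

/-! ### From runs to derivations and back -/

theorem Deriv.run {Y k} (hd : Deriv T F Y k) : ∀ γ : List Γ, γ.head? = Y.2.1 →
    ∃ p' γ', Run T Y.1 γ k p' γ' ∧ (∀ q, Y.2.2 = some q → p' = q ∧ γ' = γ) ∧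
      (Y.2.2 = none → F p' γ'.head?) := by
  induction hd with
  | nil p => exact fun γ _ => ⟨p, γ, .refl _ _, by simp⟩
  | @final p _ h => rintro γ rfl; exact ⟨p, γ, .refl _ _, by simpa using h⟩
  | keep h _ ih =>
    rintro γ rfl
    obtain ⟨p', γ', hr, h'⟩ := ih γ rfl
    exact ⟨p', γ', .step h hr, h'⟩
  | popEmpty h _ ih =>
    intro γ hγ
    obtain rfl : γ = [] := by simpa using hγ
    obtain ⟨p', γ', hr, h'⟩ := ih [] rfl
    exact ⟨p', γ', .step h hr, h'⟩
  | @call p z k s p₁ k₁ p₂ k₂ p₃ o k₃ h _ h₂ _ ih₁ ih₃ =>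
    rintro γ rfl
    obtain ⟨_, _, hr₁, h₁, -⟩ := ih₁ (s :: γ) rfl
    obtain ⟨rfl, rfl⟩ := h₁ _ rfl
    obtain ⟨p', γ', hr₃, h₃⟩ := ih₃ γ rfl
    refine ⟨p', γ', ?_, h₃⟩
    have := Run.step h (hr₁.trans (Run.step (γ := s :: γ) h₂ hr₃))
    simpa only [add_assoc] using this
  | pend h _ ih =>
    rintro γ rfl
    obtain ⟨p', γ', hr, h'⟩ := ih (_ :: γ) rfl
    exact ⟨p', γ', .step h hr, by simp, h'.2⟩

/-- A run to a situation satisfying `F`, decomposed at the moments at which the store gets lower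
than ever before. -/
inductive Descent (T : PushdownSystem X Γ W) (F : X → Option Γ → Prop) : X → List Γ → W → Prop
  | stay {p γ k} (h : Deriv T F (p, γ.head?, none) k) : Descent T F p γ k
  | down {p s γ k₁ p₂ k₂ p₃ k₃} (hd : Deriv T F (p, some s, some p₂) k₁)
      (h : T p₂ (some s) k₂ .pop p₃) (hr : Descent T F p₃ γ k₃) :
      Descent T F p (s :: γ) (k₁ + k₂ + k₃)

/-- Steps are put in front one at a time. After a push, either the new symbol is never popped
(`pend`), or its first descent closes a `call`, which is joined to the derivation that follows. -/
theorem Run.descent {p γ k p' γ'} (hr : Run T p γ k p' γ') (hF : F p' γ'.head?) :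
    Descent T F p γ k := by
  induction hr with
  | refl => exact .stay (.final hF)
  | @step p γ k op p₁ k' _ _ h _ ih =>
    have ih := ih hF
    cases op with
    | keep =>
      cases ih with
      | stay hd => exact .stay (.keep h hd)
      | down hd h₂ hr =>
        convert Descent.down (.keep h hd) h₂ hr using 1
        abel
    | pop =>
      cases γ with
      | nil =>
        cases ih with
        | stay hd => exact .stay (.popEmpty h hd)
      | cons s γ =>
        have ih : Descent T F p₁ γ k' := ih
        simpa using Descent.down (.nil _ _) h ih
    | push s =>
      cases ih with
      | stay hd => exact .stay (.pend h hd)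
      | down hd h₂ hr =>
        cases hr with
        | stay hd₃ =>
          convert Descent.stay (.call h hd h₂ hd₃) using 1
          abel
        | down hd₃ h₃ hr =>
          convert Descent.down (.call h hd h₂ hd₃) h₃ hr using 1
          abel

/-- **Pumping lemma**: a run with sufficiently many marks can be pumped at two places, before
and after which the control states agree. -/
theorem Run.pumping [Finite X] [Finite Γ] {μ : W →+ ℕ} {w : W →+ ℤ}
    (hμ : ∀ p z k op p', T p z k op p' → μ k ≤ 1)
    (hw : ∀ p z k op p', T p z k op p' → w k = op.shift) {p k p' γ'} (hr : Run T p [] k p' γ')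
    (hk : 2 ^ (Nat.card (X × Option Γ × Option X) + 2) ≤ μ k) :
    ∃ q q' kv kx k₀, Path T q kv q ∧ Path T q' kx q' ∧ k = k₀ + (kv + kx) ∧ 1 ≤ μ (kv + kx) ∧
      (kx = 0 ∨ w kv + w kx = 0 ∧ 1 ≤ w kv) ∧
      ∀ n : ℕ, ∃ γ'', γ''.head? = γ'.head? ∧ Run T p [] (k + n • (kv + kx)) p' γ'' := by
  -- The store is empty at the start, so `down` cannot occur. `F` records the final control state
  -- and top symbol, which pumping must preserve.
  cases hr.descent (F := fun q z => q = p' ∧ z = γ'.head?) ⟨rfl, rfl⟩ with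
  | stay hd =>
    obtain ⟨⟨q, z, o⟩, kv, kx, kv', kx', k', hc, hc', hd', rfl, h1⟩ := hd.pumpable μ hμ hk
    have hpump : ∀ n : ℕ, ∃ γ'', γ''.head? = γ'.head? ∧
        Run T p [] (kv + (kv' + k' + kx') + kx + n • (kv' + kx')) p' γ'' := by
      intro n
      -- One copy belongs to the given run, the other `n` are new.
      have := hc.plug ((hc'.iterate (n + 1)).plug hd')
      obtain ⟨_, γ'', hr', -, hF⟩ := this.run [] rfl
      obtain ⟨rfl, h⟩ := hF rfl
      refine ⟨γ'', h, ?_⟩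
      convert hr' using 1
      rw [succ_nsmul, succ_nsmul, nsmul_add]
      abel
    by_cases hx : kx' = 0
    · exact ⟨q, q, kv', kx', kv + k' + kx, hc'.path_left, hx ▸ .refl _, by abel, h1, .inl hx, hpump⟩
    · cases z with
      | none => exact (hx (hc'.right_eq_zero (.inl rfl))).elim
      | some z =>
        cases o with
        | none => exact (hx (hc'.right_eq_zero (.inr rfl))).elim
        | some q' =>
          exact ⟨q, q', kv', kx', kv + k' + kx, hc'.path_left, hc'.path_right _ _ rfl rfl, by abel,
            h1, .inr ⟨hc'.balanced hw rfl rfl, ((hc'.shift_left hw rfl).2).resolve_left hx⟩, hpump⟩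

end PushdownSystem

/-! ### Determinism of the non-returning mode -/

/-- The first letter outside `t` has a unique position, so the letter to be processed is determined.
-/
theorem append_cons_unique {A : Type} {t : Set A} {a a' : A} {y y' : List A} (ha : a ∉ t)
    (ha' : a' ∉ t) : ∀ {x x' : List A}, (∀ c ∈ x, c ∈ t) → (∀ c ∈ x', c ∈ t) →
      x ++ a :: y = x' ++ a' :: y' → x = x' ∧ a = a' ∧ y = y'
  | [], [], _, _, h => by simpa using h
  | [], c :: x', _, hx', h => by
    simp only [List.nil_append, List.cons_append, List.cons.injEq] at h
    exact (ha (h.1 ▸ hx' c (by simp))).elim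
  | c :: x, [], hx, _, h => by
    simp only [List.nil_append, List.cons_append, List.cons.injEq] at h
    exact (ha' (h.1 ▸ hx c (by simp))).elim
  | c :: x, c' :: x', hx, hx', h => by
    simp only [List.cons_append, List.cons.injEq] at h
    obtain ⟨rfl, h⟩ := append_cons_unique ha ha' (fun d hd => hx d (by simp [hd]))
      (fun d hd => hx' d (by simp [hd])) h.2
    simp_all

theorem Outcome.AtMostOne.eq {α : Type} {S : Set α} (h : (Outcome.goto S).AtMostOne) {x y : α}
    (hx : x ∈ S) (hy : y ∈ S) : x = y :=
  Set.encard_le_one_iff.1 h x y hx hy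

namespace NIDPDAwtl

variable {A : Type} (M : NIDPDAwtl A)

/-- Processing the letter `a` in state `q` with topmost pushdown symbol `z` can lead to state `q'`
with effect `op` on the pushdown store. -/
inductive Moves : M.State → A → Option M.Stack → StackOp M.Stack → M.State → Prop
  | push {q a z q' s S} (ha : M.sig a = .push) (hS : M.δD q a z = .goto S)
      (h : (q', s) ∈ S) : Moves q a z (.push s) q'
  | pop {q a z q' S} (ha : M.sig a = .pop) (hS : M.δR q a z = .goto S)
      (h : q' ∈ S) : Moves q a z .pop q'
  | neutral {q a z q' S} (ha : M.sig a = .neutral) (hS : M.δN q (some a) z = .goto S)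
      (h : q' ∈ S) : Moves q a z .keep q'

variable {M}

theorem Moves.processes {q a γ op q'} (h : M.Moves q a γ.head? op q') :
    M.Processes q a γ q' (op.apply γ) := by
  cases h with
  | push ha hS h => exact .push ha hS h
  | pop ha hS h => exact .pop ha hS h
  | neutral ha hS h => exact .neutral ha hS h

theorem Processes.moves {q a γ q' γ'} (h : M.Processes q a γ q' γ') :
    ∃ op, M.Moves q a γ.head? op q' ∧ γ' = op.apply γ := by
  cases h with
  | push ha hS h => exact ⟨_, .push ha hS h, rfl⟩
  | pop ha hS h => exact ⟨_, .pop ha hS h, rfl⟩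
  | neutral ha hS h => exact ⟨_, .neutral ha hS h, rfl⟩

theorem LetterAccepts.congr {q a γ γ'} (h : M.LetterAccepts q a γ) (hγ : γ'.head? = γ.head?) :
    M.LetterAccepts q a γ' := by
  cases h with
  | push ha h => exact .push ha (hγ ▸ h)
  | pop ha h => exact .pop ha (hγ ▸ h)
  | neutral ha h => exact .neutral ha (hγ ▸ h)

theorem IsDeterministic.moves (hM : M.IsDeterministic) {q a z op op' q' q''}
    (h : M.Moves q a z op q') (h' : M.Moves q a z op' q'') : op = op' ∧ q' = q'' := by
  obtain ⟨hD, hR, hN, -⟩ := hM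
  cases h with
  | push ha hS h =>
    cases h' with
    | push _ hS' h' =>
      obtain rfl := Outcome.goto.inj (hS.symm.trans hS')
      have := (hS ▸ hD q a z ha).eq h h'
      simp_all
    | pop ha' => simp [ha] at ha'
    | neutral ha' => simp [ha] at ha'
  | pop ha hS h =>
    cases h' with
    | pop _ hS' h' =>
      obtain rfl := Outcome.goto.inj (hS.symm.trans hS')
      exact ⟨rfl, (hS ▸ hR q a z ha).eq h h'⟩
    | push ha' => simp [ha] at ha'
    | neutral ha' => simp [ha] at ha'
  | neutral ha hS h =>
    cases h' with
    | neutral _ hS' h' =>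
      obtain rfl := Outcome.goto.inj (hS.symm.trans hS')
      exact ⟨rfl, (hS ▸ hN q a z ha).eq h h'⟩
    | push ha' => simp [ha] at ha'
    | pop ha' => simp [ha] at ha'

theorem Moves.not_letterAccepts {q a γ op q'} (h : M.Moves q a γ.head? op q') :
    ¬ M.LetterAccepts q a γ := by
  intro h'
  cases h <;> cases h' <;> simp_all

theorem IsDeterministic.nrStep (hM : M.IsDeterministic) : Relator.RightUnique M.NRStep := by
  have hno : ∀ {x y : List A} {a : A} {t : Set A}, a ∉ t → (∀ c ∈ x ++ a :: y, c ∈ t) → False :=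
    fun ha h => ha (h _ (by simp))
  have key : ∀ {C u q w γ}, C = NRConfig.run u q w γ → ∀ {D D'}, M.NRStep C D →
      M.NRStep (.run u q w γ) D' → D = D' := by
    intro C u q w γ hC D D' h h'
    cases h with
    | letter hx ha h =>
      cases hC
      obtain ⟨op, hm, rfl⟩ := h.moves
      generalize hw : _ ++ _ :: _ = w at h'
      cases h' with
      | letter hx' ha' h' =>
        obtain ⟨op', hm', rfl⟩ := h'.moves
        obtain ⟨rfl, rfl, rfl⟩ := append_cons_unique ha ha' hx hx' hw
        obtain ⟨rfl, rfl⟩ := hM.moves hm hm'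
        rfl
      | letterAccept hx' ha' h' =>
        obtain ⟨rfl, rfl, rfl⟩ := append_cons_unique ha ha' hx hx' hw
        exact (hm.not_letterAccepts h').elim
      | endmarker hx' => exact (hno ha (hw ▸ hx')).elim
      | endmarkerAccept hx' => exact (hno ha (hw ▸ hx')).elim
    | letterAccept hx ha h =>
      cases hC
      generalize hw : _ ++ _ :: _ = w at h'
      cases h' with
      | letter hx' ha' h' =>
        obtain ⟨op', hm', rfl⟩ := h'.moves
        obtain ⟨rfl, rfl, rfl⟩ := append_cons_unique ha ha' hx hx' hw
        exact (hm'.not_letterAccepts h).elim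
      | letterAccept => rfl
      | endmarker hx' => exact (hno ha (hw ▸ hx')).elim
      | endmarkerAccept hx' => exact (hno ha (hw ▸ hx')).elim
    | endmarker hx hS h =>
      cases hC
      cases h' with
      | letter _ ha' => exact (hno ha' hx).elim
      | letterAccept _ ha' => exact (hno ha' hx).elim
      | endmarker _ hS' h' =>
        obtain rfl := Outcome.goto.inj (hS.symm.trans hS')
        have hd := hM.2.2.2 q γ.head?
        rw [hS] at hd
        rw [hd.eq h h']
      | endmarkerAccept _ hS' => simp [hS] at hS'
    | endmarkerAccept hx hS =>
      cases hC
      cases h' with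
      | letter _ ha' => exact (hno ha' hx).elim
      | letterAccept _ ha' => exact (hno ha' hx).elim
      | endmarker _ hS' => simp [hS] at hS'
      | endmarkerAccept => rfl
  intro C D D' h h'
  cases C with
  | run => exact key rfl h h'
  | accept => cases h

/-- The computation is a single chain and `accept` has no successor, so it must lie after every
other configuration reached. -/
theorem IsDeterministic.accept_iff (hM : M.IsDeterministic) {C C' : M.NRConfig}
    (h : Relation.ReflTransGen M.NRStep C C') :
    Relation.ReflTransGen M.NRStep C .accept ↔ Relation.ReflTransGen M.NRStep C' .accept := by
  refine ⟨fun h' => ?_, h.trans⟩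
  rcases Relation.ReflTransGen.total_of_right_unique hM.nrStep h h' with h'' | h''
  · exact h''
  · rcases Relation.ReflTransGen.cases_head h'' with rfl | ⟨_, h'', _⟩
    · exact .refl
    · cases h''

end NIDPDAwtl

/-! ### Words made of blocks -/

section Blocks

variable {A : Type} {m : ℕ} (l : Fin m → A)

/-- The word with `c k` letters `l k` for each `k` in the list. -/
def blocks (c : Fin m → ℕ) (L : List (Fin m)) : List A :=
  L.flatMap fun k => List.replicate (c k) (l k)

/-- The set of empty blocks. -/
def exhausted (c : Fin m → ℕ) : Set (Fin m) := {k | c k = 0}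

/-- When the letters in `t` are translucent and the blocks in `f` are empty, block `k` is the
first one that is visible among those starting with `r`. -/
def Visible (t : Set A) (r : Fin m) (f : Set (Fin m)) (k : Fin m) : Prop :=
  r ≤ k ∧ k ∉ f ∧ l k ∉ t ∧ ∀ j, r ≤ j → j < k → j ∉ f → l j ∈ t

/-- No block starting with `r` is visible. -/
def NoneVisible (t : Set A) (r : Fin m) (f : Set (Fin m)) : Prop :=
  ∀ j, r ≤ j → j ∉ f → l j ∈ t

variable {l}

theorem mem_blocks {c : Fin m → ℕ} {L a} :
    a ∈ blocks l c L ↔ ∃ k ∈ L, c k ≠ 0 ∧ a = l k := by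
  simp [blocks, List.mem_replicate]

theorem mem_drop_finRange {r : ℕ} {k : Fin m} : k ∈ (List.finRange m).drop r ↔ r ≤ k := by
  simp only [List.mem_drop_iff_getElem, List.getElem_finRange, List.length_finRange]
  constructor
  · rintro ⟨j, hj, rfl⟩
    simp
  · intro h
    exact ⟨k - r, by omega, by ext; simp; omega⟩

theorem mem_take_finRange {r : ℕ} {k : Fin m} : k ∈ (List.finRange m).take r ↔ (k : ℕ) < r := by
  simp only [List.mem_take_iff_getElem, List.getElem_finRange, List.length_finRange]
  constructor
  · rintro ⟨j, hj, rfl⟩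
    simp; omega
  · intro h
    exact ⟨k, by omega, by simp⟩

theorem blocks_congr {c c' : Fin m → ℕ} {L} (h : ∀ k ∈ L, c k = c' k) :
    blocks l c L = blocks l c' L := by
  induction L with
  | nil => rfl
  | cons k L ih => simp_all [blocks]

theorem blocks_append {c : Fin m → ℕ} {L L'} :
    blocks l c (L ++ L') = blocks l c L ++ blocks l c L' := by
  simp [blocks]

/-- The word is brought into the shape that a letter step requires. The skipped word `x` consists of
whole blocks, so after the deletion the head stands exactly before the rest of block `k`. -/
theorem blocks_split {c c' : Fin m → ℕ} {t : Set A} {r k : Fin m} (hc : c = Pi.single k 1 + c')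
    (hv : Visible l t r (exhausted c) k) : ∃ x, (∀ a ∈ x, a ∈ t) ∧
      blocks l c ((List.finRange m).drop r) =
        x ++ l k :: blocks l c' ((List.finRange m).drop k) ∧
      blocks l c ((List.finRange m).take r) ++ x = blocks l c' ((List.finRange m).take k) := by
  obtain ⟨hrk, -, -, hv⟩ := hv
  have hrk' : (r : ℕ) + (k - r) = k := by have : (r : ℕ) ≤ k := hrk; omega
  have hne : ∀ j, j ≠ k → c j = c' j := fun j hj => by simp [hc, hj]
  refine ⟨blocks l c (((List.finRange m).drop r).take (k - r)), ?_, ?_, ?_⟩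
  · intro a ha
    obtain ⟨j, hj, hj0, rfl⟩ := mem_blocks.1 ha
    have h1 := mem_drop_finRange.1 (List.mem_of_mem_take hj)
    rw [← List.drop_take] at hj
    have h2 := mem_take_finRange.1 (List.mem_of_mem_drop hj)
    exact hv j h1 h2 hj0
  · conv_lhs => rw [← List.take_append_drop (k - r) ((List.finRange m).drop r)]
    rw [blocks_append, List.drop_drop, hrk',
      List.drop_eq_getElem_cons (by simp : (k : ℕ) < (List.finRange m).length)]
    congr 1
    simp only [List.getElem_finRange, Fin.cast_mk, Fin.eta]
    have h1 : blocks l c ((List.finRange m).drop (k + 1)) =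
        blocks l c' ((List.finRange m).drop (k + 1)) := by
      refine blocks_congr fun j hj => hne j ?_
      rintro rfl
      have := mem_drop_finRange.1 hj
      omega
    simp only [blocks, List.flatMap_cons] at h1 ⊢
    rw [h1, hc]
    simp [Nat.add_comm 1, List.replicate_succ]
  · rw [← blocks_append, ← List.drop_take]
    have : (List.finRange m).take r = ((List.finRange m).take k).take r := by
      rw [List.take_take, min_eq_left (by exact_mod_cast hrk)]
    rw [this, List.take_append_drop]
    refine blocks_congr fun j hj => hne j ?_
    rintro rfl
    have := mem_take_finRange.1 hj
    omega

theorem noneVisible_iff {c : Fin m → ℕ} {t : Set A} {r : Fin m} :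
    NoneVisible l t r (exhausted c) ↔ ∀ a ∈ blocks l c ((List.finRange m).drop r), a ∈ t := by
  constructor
  · intro h a ha
    obtain ⟨j, hj, hj0, rfl⟩ := mem_blocks.1 ha
    exact h j (mem_drop_finRange.1 hj) hj0
  · intro h j hj hj0
    exact h _ (mem_blocks.2 ⟨j, mem_drop_finRange.2 hj, hj0, rfl⟩)

theorem exists_visible {t : Set A} {r : Fin m} {f : Set (Fin m)} (h : ¬ NoneVisible l t r f) :
    ∃ k, Visible l t r f k := by
  obtain ⟨k, ⟨h1, h2, h3⟩, hmin⟩ := wellFounded_lt.has_min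
    {k : Fin m | r ≤ k ∧ k ∉ f ∧ l k ∉ t} (by simpa [NoneVisible, Set.Nonempty] using h)
  refine ⟨k, h1, h2, h3, fun j hj hjk hjf => ?_⟩
  by_contra hjt
  exact hmin j ⟨hj, hjf, hjt⟩ hjk

theorem exists_eq_single_add {c : Fin m → ℕ} {k : Fin m} (h : k ∉ exhausted c) :
    ∃ c' : Fin m → ℕ, c = Pi.single k 1 + c' := by
  refine ⟨Function.update c k (c k - 1), funext fun j => ?_⟩
  have h : c k ≠ 0 := h
  by_cases hj : j = k
  · subst hj; simp; omega
  · simp [hj]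

theorem visible_of_eq {c : Fin m → ℕ} {t : Set A} {r : Fin m} {x a y} (hx : ∀ c ∈ x, c ∈ t)
    (ha : a ∉ t) (h : blocks l c ((List.finRange m).drop r) = x ++ a :: y) :
    ∃ k, Visible l t r (exhausted c) k ∧ a = l k := by
  obtain ⟨k, hk⟩ := exists_visible (l := l) (t := t) (r := r) (f := exhausted c) (by
    rw [noneVisible_iff, h]
    exact fun h' => ha (h' a (by simp)))
  obtain ⟨c', hc'⟩ := exists_eq_single_add hk.2.1
  obtain ⟨x', hx', h', -⟩ := blocks_split hc' hk
  exact ⟨k, hk, (append_cons_unique ha hk.2.2.1 hx hx' (h.symm.trans h')).2.1⟩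

end Blocks

/-! ### Automata on block words as pushdown systems -/

namespace NIDPDAwtl

open Relation PushdownSystem

variable {A : Type} (M : NIDPDAwtl A) {m : ℕ} [NeZero m] (l : Fin m → A)

/-- The configuration with block word given by `c`, the head standing before block `r`. -/
def blockConfig (q : M.State) (r : Fin m) (c : Fin m → ℕ) (γ : List M.Stack) : M.NRConfig :=
  .run (blocks l c ((List.finRange m).take r)) q (blocks l c ((List.finRange m).drop r)) γ

/-- The pushdown system that describes `M` on block words: its control states are the states of
`M` together with the head position and the set of empty blocks; weights count the deleted
letters. The blocks in `once` are assumed to have at most one letter. -/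
inductive blockSystem (once : Set (Fin m)) :
    PushdownSystem (M.State × Fin m × Set (Fin m)) M.Stack (Fin m → ℕ)
  | letter {q r f z k op q' f'} (hv : Visible l (M.τ q) r f k) (hm : M.Moves q (l k) z op q')
      (hf : ∀ j, j ≠ k → (j ∈ f' ↔ j ∈ f)) (ho : k ∈ once → k ∈ f') :
      blockSystem once (q, r, f) z (Pi.single k 1) op (q', k, f')
  | endmarker {q r f z q' S} (hv : NoneVisible l (M.τ q) r f) (hS : M.δN q none z = .goto S)
      (h : q' ∈ S) : blockSystem once (q, r, f) z 0 .keep (q', 0, f)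

/-- A step on the endmarker, with topmost pushdown symbol `z` and empty blocks `f`. -/
def EndStep (f : Set (Fin m)) (z : Option M.Stack) (x y : M.State × Fin m) : Prop :=
  NoneVisible l (M.τ x.1) x.2 f ∧ (∃ S, M.δN x.1 none z = .goto S ∧ y.1 ∈ S) ∧ y.2 = 0

/-- No more letters will be deleted, except in an accepting step. -/
def Idle (f : Set (Fin m)) (z : Option M.Stack) (x : M.State × Fin m) : Prop :=
  ∀ y, ReflTransGen (M.EndStep l f z) x y → ∀ k op q', Visible l (M.τ y.1) y.2 f k →
    ¬ M.Moves y.1 (l k) z op q'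

variable {M l}

omit [NeZero m] in
theorem nrStep_blockConfig {q : M.State} {r k : Fin m} {c c' : Fin m → ℕ} {γ q' γ'}
    (hc : c = Pi.single k 1 + c') (hv : Visible l (M.τ q) r (exhausted c) k)
    (h : M.Processes q (l k) γ q' γ') :
    M.NRStep (M.blockConfig l q r c γ) (M.blockConfig l q' k c' γ') := by
  obtain ⟨x, hx, h1, h2⟩ := blocks_split hc hv
  rw [blockConfig, blockConfig, h1, ← h2]
  exact .letter hx hv.2.2.1 h

omit [NeZero m] in
theorem nrStep_blockConfig_accept {q : M.State} {r k : Fin m} {c : Fin m → ℕ} {γ}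
    (hv : Visible l (M.τ q) r (exhausted c) k) (h : M.LetterAccepts q (l k) γ) :
    M.NRStep (M.blockConfig l q r c γ) .accept := by
  obtain ⟨c', hc⟩ := exists_eq_single_add hv.2.1
  obtain ⟨x, hx, h1, -⟩ := blocks_split hc hv
  rw [blockConfig, h1]
  exact .letterAccept hx hv.2.2.1 h

theorem nrStep_blockConfig_end {q : M.State} {r : Fin m} {c : Fin m → ℕ} {γ q' S}
    (hv : NoneVisible l (M.τ q) r (exhausted c)) (hS : M.δN q none γ.head? = .goto S)
    (h : q' ∈ S) : M.NRStep (M.blockConfig l q r c γ) (M.blockConfig l q' 0 c γ) := by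
  have := NRStep.endmarker (u := blocks l c ((List.finRange m).take r)) (noneVisible_iff.1 hv) hS h
  rw [← blocks_append, List.take_append_drop] at this
  simpa [blockConfig, blocks] using this

/-- At a letter step the pushdown system guesses whether block `k` becomes empty. Prescribing the
final remainder `c'` makes all guesses correct, by induction from the end of the run. -/
theorem realize {once : Set (Fin m)} {x x' : M.State × Fin m × Set (Fin m)} {γ γ' κ}
    (h : Run (M.blockSystem l once) x γ κ x' γ') : ∀ c', exhausted c' = x'.2.2 →
      exhausted (κ + c') = x.2.2 ∧ ReflTransGen M.NRStep (M.blockConfig l x.1 x.2.1 (κ + c') γ)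
        (M.blockConfig l x'.1 x'.2.1 c' γ') := by
  induction h with
  | refl => intro c' hc'; exact ⟨by rwa [zero_add], by rw [zero_add]⟩
  | @step x γ k op x₁ κ' x' γ' h _ ih =>
    intro c' hc'
    obtain ⟨h1, h2⟩ := ih c' hc'
    cases h with
    | @letter q r f _ k _ q' f' hv hm hf =>
      have he : exhausted (Pi.single k 1 + κ' + c') = f := by
        ext j
        by_cases hj : j = k
        · subst hj; simpa [exhausted] using hv.2.1
        · rw [← hf j hj, show f' = _ from h1.symm]
          simp [exhausted, hj]
      refine ⟨he, .head (nrStep_blockConfig (add_assoc _ _ _) (by rwa [he]) hm.processes) h2⟩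
    | endmarker hv hS h =>
      rw [zero_add]
      exact ⟨h1, .head (nrStep_blockConfig_end (by rwa [h1]) hS h) h2⟩

theorem nrStep_blockConfig_cases {q : M.State} {r : Fin m} {c : Fin m → ℕ} {γ C}
    (h : M.NRStep (M.blockConfig l q r c γ) C) :
    (∃ k op q', Visible l (M.τ q) r (exhausted c) k ∧ M.Moves q (l k) γ.head? op q') ∨
    (∃ k, Visible l (M.τ q) r (exhausted c) k ∧ M.LetterAccepts q (l k) γ ∧ C = .accept) ∨
    (∃ S q', NoneVisible l (M.τ q) r (exhausted c) ∧ M.δN q none γ.head? = .goto S ∧ q' ∈ S ∧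
      C = M.blockConfig l q' 0 c γ) ∨
    (NoneVisible l (M.τ q) r (exhausted c) ∧ M.δN q none γ.head? = .accept ∧ C = .accept) := by
  rw [blockConfig] at h
  generalize hu : blocks l c ((List.finRange m).take r) = u at h
  generalize hw : blocks l c ((List.finRange m).drop r) = w at h
  cases h with
  | letter hx ha h =>
    obtain ⟨k, hk, rfl⟩ := visible_of_eq hx ha hw
    obtain ⟨op, h, -⟩ := h.moves
    exact .inl ⟨k, op, _, hk, h⟩
  | letterAccept hx ha h =>
    obtain ⟨k, hk, rfl⟩ := visible_of_eq hx ha hw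
    exact .inr (.inl ⟨k, hk, h, rfl⟩)
  | endmarker hx hS h =>
    refine .inr (.inr (.inl ⟨_, _, noneVisible_iff.2 (hw ▸ hx), hS, h, ?_⟩))
    rw [← hu, ← hw, ← blocks_append, List.take_append_drop]
    simp [blockConfig, blocks]
  | endmarkerAccept hx hS => exact .inr (.inr (.inr ⟨noneVisible_iff.2 (hw ▸ hx), hS, rfl⟩))

/-- From an idle situation only endmarker and accepting steps occur. Both depend only on which
blocks are empty and on the top symbol. -/
theorem accept_of_idle {C : M.NRConfig} (h : ReflTransGen M.NRStep C .accept) :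
    ∀ (q : M.State) (r : Fin m) (c c' : Fin m → ℕ) (γ γ'), C = M.blockConfig l q r c γ →
      M.Idle l (exhausted c) γ.head? (q, r) → exhausted c' = exhausted c →
      γ'.head? = γ.head? → ReflTransGen M.NRStep (M.blockConfig l q r c' γ') .accept := by
  induction h using ReflTransGen.head_induction_on with
  | refl => intro q r c c' γ γ' h; simp [blockConfig] at h
  | head h _ ih =>
    rintro q r c c' γ γ' rfl hidle hc hγ
    rcases nrStep_blockConfig_cases h with ⟨k, op, q', hv, hm⟩ | ⟨k, hv, ha, -⟩ |
      ⟨S, q', hv, hS, hq', rfl⟩ | ⟨hv, ha, -⟩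
    · exact (hidle _ .refl k op q' hv hm).elim
    · exact .single (nrStep_blockConfig_accept (by rwa [hc]) (ha.congr hγ))
    · refine .head (nrStep_blockConfig_end (by rwa [hc]) (by rwa [hγ]) hq')
        (ih q' 0 c c' γ γ' rfl ?_ hc hγ)
      exact fun y hy => hidle y (.head ⟨hv, ⟨S, hS, hq'⟩, rfl⟩ hy)
    · exact .single (.endmarkerAccept (noneVisible_iff.1 (by rwa [hc])) (by rwa [hγ]))

theorem accept_iff_of_idle {q : M.State} {r : Fin m} {c c' : Fin m → ℕ} {γ γ'}
    (hi : M.Idle l (exhausted c) γ.head? (q, r)) (hc : exhausted c' = exhausted c)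
    (hγ : γ'.head? = γ.head?) :
    ReflTransGen M.NRStep (M.blockConfig l q r c γ) .accept ↔
      ReflTransGen M.NRStep (M.blockConfig l q r c' γ') .accept :=
  ⟨fun h => accept_of_idle h q r c c' γ γ' rfl hi hc hγ,
    fun h => accept_of_idle h q r c' c γ' γ rfl (by rwa [hc, hγ]) hc.symm hγ.symm⟩

theorem run_of_endSteps {once f : Set (Fin m)} {γ} {x y : M.State × Fin m}
    (h : ReflTransGen (M.EndStep l f γ.head?) x y) :
    Run (M.blockSystem l once) (x.1, x.2, f) γ 0 (y.1, y.2, f) γ := by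
  induction h using ReflTransGen.head_induction_on with
  | refl => exact .refl _ _
  | @head x x' h _ ih =>
    obtain ⟨hv, ⟨S, hS, h⟩, h0⟩ := h
    have := Run.step (γ := γ) (blockSystem.endmarker (once := once) hv hS h) (h0 ▸ ih)
    simpa using this

/-- Endless loops on the endmarker are harmless: a situation that is not idle reaches a deletion by
endmarker steps, and there are at most `n` deletions. -/
theorem exists_idle (once : Set (Fin m)) (n : ℕ) : ∀ (q : M.State) (r : Fin m) (c : Fin m → ℕ) γ,
    (∀ k ∈ once, c k ≤ 1) → ∑ k, c k ≤ n → ∃ κ c' q' r' γ', c = κ + c' ∧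
      Run (M.blockSystem l once) (q, r, exhausted c) γ κ (q', r', exhausted c') γ' ∧
      M.Idle l (exhausted c') γ'.head? (q', r') := by
  induction n with
  | zero =>
    intro q r c γ _ hc
    refine ⟨0, c, q, r, γ, (zero_add c).symm, .refl _ _, fun y _ k op q' hv => ?_⟩
    exact (hv.2.1 ((Finset.sum_eq_zero_iff.1 (by omega : ∑ k, c k = 0)) k (by simp))).elim
  | succ n ih =>
    intro q r c γ ho hc
    by_cases hidle : M.Idle l (exhausted c) γ.head? (q, r)
    · exact ⟨0, c, q, r, γ, (zero_add c).symm, .refl _ _, hidle⟩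
    simp only [Idle, not_forall, not_not] at hidle
    obtain ⟨y, hy, k, op, q₁, hv, hm⟩ := hidle
    obtain ⟨c₁, rfl⟩ := exists_eq_single_add hv.2.1
    have ho₁ : ∀ j ∈ once, c₁ j ≤ 1 := fun j hj => le_trans (by simp) (ho j hj)
    have hsum : ∑ j, c₁ j ≤ n := by
      simp only [Pi.add_apply, Finset.sum_add_distrib, Finset.sum_pi_single', Finset.mem_univ,
        if_true] at hc
      omega
    obtain ⟨κ, c', q', r', γ', rfl, hr, hi⟩ := ih q₁ k c₁ (op.apply γ) ho₁ hsum
    refine ⟨Pi.single k 1 + κ, c', q', r', γ', (add_assoc _ _ _).symm, ?_, hi⟩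
    have hstep : M.blockSystem l once (y.1, y.2, exhausted (Pi.single k 1 + (κ + c'))) γ.head?
        (Pi.single k 1) op (q₁, k, exhausted (κ + c')) := by
      refine .letter hv hm (fun j hj => by simp [exhausted, hj]) fun hk => ?_
      have := ho k hk
      simp only [Pi.add_apply, Pi.single_eq_same] at this
      change κ k + c' k = 0
      omega
    simpa using (run_of_endSteps (once := once) hy).trans (.step hstep hr)

end NIDPDAwtl

/-! ### Pumping the words `aⁿ bⁱ # bʲ` -/

/-- The change of the height of a nonempty pushdown store by a letter of the given kind. -/
def Kind.shift : Kind → ℤ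
  | push => 1
  | pop => -1
  | neutral => 0

theorem Kind.shift_cases (κ : Kind) : κ.shift = 0 ∨ κ.shift = 1 ∨ κ.shift = -1 := by
  cases κ <;> simp [shift]

/-- The letters of the block words `aⁿ bⁱ # bʲ`. -/
def blockLetter : Fin 4 → Letter := ![.a, .b, .hash, .b]

/-- The word `aⁿ bⁱ #ʰ bʲ`, for `c = ![n, i, h, j]`. -/
def blockWord (c : Fin 4 → ℕ) : List Letter := blocks blockLetter c (List.finRange 4)

namespace NIDPDAwtl

open Relation PushdownSystem

variable {M : NIDPDAwtl Letter}

open Classical in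
/-- A number that never decreases in a run on a word `aⁿ bⁱ # bʲ`. As long as it does not change,
letters of only one of the blocks `bⁱ` and `bʲ` are deleted. -/
noncomputable def phase (x : M.State × Fin 4 × Set (Fin 4)) : ℕ :=
  if 1 ∈ x.2.2 then 4
  else if x.2.1 ≤ 1 then (if 2 ∈ x.2.2 then 3 else 1)
  else (if 2 ∈ x.2.2 then 2 else 0)

/-- Both `b`-blocks carry the same letter. While block 1 is nonempty and the head is at or before
it, block 3 is invisible: either `b` is translucent or block 1 comes first. So the head gets past
block 1 only by deleting `#` or after emptying block 1, and it comes back only on the endmarker. -/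
theorem phase_step {x x' z κ op} (h : M.blockSystem blockLetter {2} x z κ op x') :
    phase x ≤ phase x' ∧ (phase x = phase x' →
      (phase x % 2 = 0 → κ 1 = 0) ∧ (phase x % 2 = 1 → κ 3 = 0)) := by
  cases h with
  | @letter q r f _ k _ q' f' hv hm hf ho =>
    obtain ⟨h1, h2, h3, h4⟩ := hv
    have hf1 := hf 1
    have hf2 := hf 2
    have h4 := h4 1
    simp only [phase]
    fin_cases k <;> fin_cases r <;> simp_all [blockLetter] <;> split_ifs <;> simp_all
  | endmarker =>
    simp only [phase]
    split_ifs <;> simp_all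

-- Since `once = {2}`, deleting `#` marks block 2 as empty for good.
open Classical in
theorem hash_step {x x' z κ op} (h : M.blockSystem blockLetter {2} x z κ op x') :
    κ 2 + (if 2 ∈ x'.2.2 then 0 else 1) ≤ if 2 ∈ x.2.2 then 0 else 1 := by
  cases h with
  | @letter q r f _ k _ q' f' hv hm hf ho =>
    have hf2 := hf 2
    have h2 := hv.2.1
    by_cases hk : 2 = k
    · subst hk
      have := ho rfl
      simp_all
    · simp_all
  | endmarker => simp

theorem phase_path {x x' κ} (h : Path (M.blockSystem blockLetter {2}) x κ x') :
    phase x ≤ phase x' ∧ (phase x = phase x' →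
      (phase x % 2 = 0 → κ 1 = 0) ∧ (phase x % 2 = 1 → κ 3 = 0)) := by
  induction h with
  | refl => simp
  | step h _ ih =>
    obtain ⟨h1, h2⟩ := phase_step h
    obtain ⟨h3, h4⟩ := ih
    refine ⟨h1.trans h3, fun he => ?_⟩
    have e1 := h1.antisymm (h3.trans he.ge)
    have e2 := e1.symm.trans he
    have h2 := h2 e1
    have h4 := h4 e2
    simp only [Pi.add_apply, Nat.add_eq_zero_iff]
    exact ⟨fun hp => ⟨h2.1 hp, h4.1 (e1 ▸ hp)⟩, fun hp => ⟨h2.2 hp, h4.2 (e1 ▸ hp)⟩⟩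

open Classical in
theorem hash_path {x x' κ} (h : Path (M.blockSystem blockLetter {2}) x κ x') :
    κ 2 + (if 2 ∈ x'.2.2 then 0 else 1) ≤ if 2 ∈ x.2.2 then 0 else 1 := by
  induction h with
  | refl => simp
  | step h _ ih =>
    have := hash_step h
    simp only [Pi.add_apply]
    omega

/-- On a closed path no `#` is deleted, and letters of at most one of the two `b`-blocks. -/
theorem closed_path {x κ} (h : Path (M.blockSystem blockLetter {2}) x κ x) :
    κ 2 = 0 ∧ (κ 1 = 0 ∨ κ 3 = 0) := by
  have h1 := (phase_path h).2 rfl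
  have h2 := hash_path h
  refine ⟨by omega, ?_⟩
  rcases Nat.mod_two_eq_zero_or_one (phase x) with h | h
  · exact .inl (h1.1 h)
  · exact .inr (h1.2 h)

variable (M) in
/-- The change of the pushdown height when letters are deleted from the blocks. -/
def blockShift : (Fin 4 → ℕ) →+ ℤ where
  toFun κ := ∑ k, (M.sig (blockLetter k)).shift * κ k
  map_zero' := by simp
  map_add' κ κ' := by simp [mul_add, Finset.sum_add_distrib]

theorem blockShift_step {once x x' z κ op} (h : M.blockSystem blockLetter once x z κ op x') :
    M.blockShift κ = op.shift := by
  cases h with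
  | @letter q r f _ k _ q' f' hv hm hf ho =>
    have : M.blockShift (Pi.single k 1) = (M.sig (blockLetter k)).shift := by
      simp [blockShift, Pi.single_apply]
    rw [this]
    cases hm with
    | push ha => rw [ha]; rfl
    | pop ha => rw [ha]; rfl
    | neutral ha => rw [ha]; rfl
  | endmarker => rw [map_zero]; rfl

/-- The letters of both `b`-blocks are of one kind, so only their total number counts. -/
theorem blockShift_apply (κ : Fin 4 → ℕ) (h : κ 2 = 0) : M.blockShift κ =
    (M.sig .a).shift * κ 0 + (M.sig .b).shift * (κ 1 + κ 3) := by
  simp [blockShift, Fin.sum_univ_four, h, blockLetter]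
  ring

theorem mem_nrLanguage_iff {c : Fin 4 → ℕ} : blockWord c ∈ M.nrLanguage ↔
    ReflTransGen M.NRStep (M.blockConfig blockLetter M.start 0 c []) .accept := by
  simp [nrLanguage, blockConfig, blockWord, blocks]
  rfl

/-- **Pumping lemma** for the words `aⁿ bⁱ # bʲ` and deterministic automata in the non-returning
mode: membership is invariant under pumping. -/
theorem IsDeterministic.pumping (hM : M.IsDeterministic) : ∃ P : ℕ, 1 ≤ P ∧
    ∀ c : Fin 4 → ℕ, c 2 ≤ 1 → P ≤ c 0 → ∃ δ : Fin 4 → ℕ, 1 ≤ δ 0 ∧ δ 0 ≤ c 0 ∧ δ 2 = 0 ∧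
      (δ 1 = 0 ∨ δ 3 = 0 ∨ δ 0 = δ 1 + δ 3) ∧
      ∀ n : ℕ, blockWord (c + n • δ) ∈ M.nrLanguage ↔ blockWord c ∈ M.nrLanguage := by
  have := M.finiteState
  have := M.finiteStack
  let X := M.State × Fin 4 × Set (Fin 4)
  refine ⟨2 ^ (Nat.card (X × Option M.Stack × Option X) + 2), Nat.one_le_two_pow, ?_⟩
  intro c hc hP
  obtain ⟨κ, c', q, r, γ, rfl, hr, hi⟩ := exists_idle (M := M) (l := blockLetter) {2} _ M.start 0
    c [] (by rintro k rfl; exact hc) le_rfl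
  -- a run with the same final situation yields the same answer
  have key : ∀ κ₁ c₁ γ₁, Run (M.blockSystem blockLetter {2})
      (M.start, 0, exhausted (κ + c')) [] κ₁ (q, r, exhausted c') γ₁ → exhausted c₁ = exhausted c' →
      γ₁.head? = γ.head? →
      (blockWord (κ₁ + c₁) ∈ M.nrLanguage ↔ blockWord (κ + c') ∈ M.nrLanguage) := by
    intro κ₁ c₁ γ₁ hr₁ hc₁ hγ₁
    rw [mem_nrLanguage_iff, mem_nrLanguage_iff, hM.accept_iff (realize hr₁ c₁ hc₁).2,
      hM.accept_iff (realize hr c' rfl).2]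
    exact (accept_iff_of_idle hi hc₁ hγ₁).symm
  by_cases hκ : 2 ^ (Nat.card (X × Option M.Stack × Option X) + 2) ≤ κ 0
  · obtain ⟨x, x', kv, kx, k₀, hv, hx, rfl, h1, h2, h3⟩ := hr.pumping
      (μ := Pi.evalAddMonoidHom (fun _ : Fin 4 => ℕ) 0) (w := M.blockShift)
      (by
        intro p z k op p' h
        cases h with
        | @letter q r f _ k =>
          simp only [Pi.evalAddMonoidHom_apply, Pi.single_apply]
          split_ifs <;> simp
        | endmarker => simp)
      (fun p z k op p' h => blockShift_step h) hκ
    simp only [Pi.evalAddMonoidHom_apply] at h1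
    obtain ⟨hv2, hv13⟩ := closed_path hv
    obtain ⟨hx2, hx13⟩ := closed_path hx
    refine ⟨kv + kx, h1, by simp; omega, by simp [hv2, hx2], ?_, ?_⟩
    · rcases h2 with rfl | ⟨h2, h4⟩
      · simpa [or_assoc] using Or.inl hv13
      · rw [blockShift_apply _ hv2] at h2 h4
        rw [blockShift_apply _ hx2] at h2
        simp only [Pi.add_apply] at h1 ⊢
        -- Zero total shift, positive shift of `kv` and a pumped `a` leave only the cases in which
        -- `a` and `b` have opposite shifts.
        rcases Kind.shift_cases (M.sig .a) with ha | ha | ha <;>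
        rcases Kind.shift_cases (M.sig .b) with hb | hb | hb <;>
        rw [ha, hb] at h2 h4 <;> omega
    · intro n
      obtain ⟨γ', hγ', hr'⟩ := h3 n
      have := key _ c' γ' hr' rfl hγ'
      rwa [add_right_comm] at this
  -- Some `a`'s survive until the idle situation, so one more does not change the set of empty
  -- blocks.
  · have hc0 : c' 0 ≠ 0 := by simp only [Pi.add_apply] at hP; omega
    refine ⟨Pi.single 0 1, by simp, by simp; omega, by simp, by simp, fun n => ?_⟩
    rw [add_assoc]
    refine key κ _ γ hr ?_ rfl
    ext j
    by_cases hj : j = 0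
    · subst hj; simp [exhausted, hc0]
    · simp [exhausted, hj]

/-- No deterministic automaton accepts a block word `aⁿ bⁱ # bʲ` iff `n = i` or `n = j`. -/
theorem IsDeterministic.not_or (hM : M.IsDeterministic) : ¬ ∀ n i j : ℕ, 1 ≤ n → 1 ≤ i → 1 ≤ j →
    (blockWord ![n, i, 1, j] ∈ M.nrLanguage ↔ n = i ∨ n = j) := by
  intro h
  obtain ⟨P, hP, hpump⟩ := hM.pumping
  have hfac := Nat.factorial_pos P
  -- This word is to be rejected. As `δ 0 ≤ P`, the surplus `P!` is a multiple of each relevant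
  -- component of `δ`, so suitable pumping makes `n` equal to one of the two block lengths.
  obtain ⟨δ, h1, h2, h3, h4, h5⟩ := hpump ![P, P + P.factorial, 1, P + P.factorial] le_rfl le_rfl
  simp only [Matrix.cons_val_zero] at h2
  have hword : ∀ n : ℕ, ![P, P + P.factorial, 1, P + P.factorial] + n • δ =
      ![P + n * δ 0, P + P.factorial + n * δ 1, 1, P + P.factorial + n * δ 3] := by
    intro n
    ext j
    fin_cases j <;> simp [h3]
  have hno : ∀ n : ℕ, n * δ 0 ≠ P.factorial + n * δ 1 ∧ n * δ 0 ≠ P.factorial + n * δ 3 := by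
    intro n
    have := h5 n
    rw [hword, h _ _ _ (by omega) (by omega) (by omega), h _ _ _ (by omega) (by omega) (by omega)]
      at this
    omega
  have hdvd : ∀ d, 1 ≤ d → d ≤ P → ∃ n, n * d = P.factorial := fun d hd hdP => by
    obtain ⟨n, hn⟩ := Nat.dvd_factorial hd hdP
    exact ⟨n, by rw [hn, mul_comm]⟩
  by_cases hz : δ 1 = 0 ∨ δ 3 = 0
  · obtain ⟨n, hn⟩ := hdvd _ h1 h2
    have := hno n
    rcases hz with hz | hz <;> simp [hz, hn] at this
  -- With `n * δ 1 = P!`, the number of `a`'s gains `P!` more than the last block does.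
  · have h4 : δ 0 = δ 1 + δ 3 := by omega
    obtain ⟨n, hn⟩ := hdvd (δ 1) (by omega) (by omega)
    have := (hno n).2
    rw [h4, mul_add] at this
    omega

/-- No deterministic automaton accepts a block word `aⁿ bⁱ # bʲ` iff `n = i` and `n = j`. -/
theorem IsDeterministic.not_and (hM : M.IsDeterministic) : ¬ ∀ n i j : ℕ, 1 ≤ n → 1 ≤ i → 1 ≤ j →
    (blockWord ![n, i, 1, j] ∈ M.nrLanguage ↔ n = i ∧ n = j) := by
  intro h
  obtain ⟨P, hP, hpump⟩ := hM.pumping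
  -- This word is to be accepted. Staying in the language would need `δ 0 = δ 1 = δ 3 ≥ 1`, which
  -- all three alternatives for `δ` exclude.
  obtain ⟨δ, h1, h2, h3, h4, h5⟩ := hpump ![P, P, 1, P] le_rfl le_rfl
  have hword : ![P, P, 1, P] + 1 • δ = ![P + δ 0, P + δ 1, 1, P + δ 3] := by
    ext j
    fin_cases j <;> simp [h3]
  have := h5 1
  rw [hword, h _ _ _ (by omega) (by omega) (by omega), h _ _ _ (by omega) (by omega) (by omega)]
    at this
  omega

end NIDPDAwtl

/-! ### Simulation of the returning mode -/

namespace Outcome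

variable {α β : Type}

/-- Apply a function to the results. -/
def map (f : α → β) : Outcome α → Outcome β
  | goto S => goto (f '' S)
  | accept => accept

theorem AtMostOne.map {f : α → β} {o : Outcome α} (h : o.AtMostOne) : (o.map f).AtMostOne := by
  cases o with
  | goto S => exact (Set.encard_image_le f S).trans h
  | accept => trivial

theorem map_eq_goto {f : α → β} {o : Outcome α} {S : Set β} (h : o.map f = .goto S) :
    ∃ S', o = .goto S' ∧ S = f '' S' := by
  cases o with
  | goto S' => exact ⟨S', rfl, (Outcome.goto.inj h).symm⟩
  | accept => cases h

theorem map_eq_accept {f : α → β} {o : Outcome α} (h : o.map f = .accept) : o = .accept := by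
  cases o with
  | goto S' => cases h
  | accept => rfl

end Outcome

namespace NIDPDAwtl

open Relation

variable {A : Type} (M : NIDPDAwtl A)

/-- An automaton that simulates, in the non-returning mode, the returning mode of `M`: after each
letter it goes to the endmarker, in a state in which all letters are translucent. -/
def returning : NIDPDAwtl A where
  State := M.State × Bool
  Stack := M.Stack
  finiteState := by have := M.finiteState; infer_instance
  finiteStack := M.finiteStack
  sig := M.sig
  start := (M.start, false)
  τ q := if q.2 then Set.univ else M.τ q.1
  δD q a z := (M.δD q.1 a z).map fun p => ((p.1, true), p.2)
  δR q a z := (M.δR q.1 a z).map fun p => (p, true)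
  δN q a z := match q.2, a with
    | true, none => .goto {(q.1, false)}
    | false, none => (M.δN q.1 none z).map fun p => (p, false)
    | _, some a => (M.δN q.1 (some a) z).map fun p => (p, true)

variable {M}

theorem IsDeterministic.returning (hM : M.IsDeterministic) : M.returning.IsDeterministic := by
  refine ⟨fun q a z ha => (hM.1 q.1 a z ha).map, fun q a z ha => (hM.2.1 q.1 a z ha).map,
    fun q a z ha => ?_, fun q z => ?_⟩
  · obtain ⟨q, _ | _⟩ := q <;> exact (hM.2.2.1 q a z ha).map
  · obtain ⟨q, _ | _⟩ := q
    · exact (hM.2.2.2 q z).map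
    · exact (Set.encard_singleton _).le

theorem Processes.returning {q a γ q' γ'} (h : M.Processes q a γ q' γ') :
    M.returning.Processes (q, false) a γ (q', true) γ' := by
  cases h with
  | push ha hS h => exact .push ha (congrArg (Outcome.map _) hS) (Set.mem_image_of_mem _ h)
  | pop ha hS h => exact .pop ha (congrArg (Outcome.map _) hS) (Set.mem_image_of_mem _ h)
  | neutral ha hS h => exact .neutral ha (congrArg (Outcome.map _) hS) (Set.mem_image_of_mem _ h)

theorem Processes.of_returning {q a γ q' γ'} (h : M.returning.Processes (q, false) a γ q' γ') :
    ∃ p, q' = (p, true) ∧ M.Processes q a γ p γ' := by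
  cases h with
  | push ha hS h =>
    obtain ⟨S, hS', rfl⟩ := Outcome.map_eq_goto hS
    obtain ⟨p, hp, h⟩ := h
    cases h
    exact ⟨_, rfl, .push ha hS' hp⟩
  | pop ha hS h =>
    obtain ⟨S, hS', rfl⟩ := Outcome.map_eq_goto hS
    obtain ⟨p, hp, rfl⟩ := h
    exact ⟨_, rfl, .pop ha hS' hp⟩
  | neutral ha hS h =>
    obtain ⟨S, hS', rfl⟩ := Outcome.map_eq_goto hS
    obtain ⟨p, hp, rfl⟩ := h
    exact ⟨_, rfl, .neutral ha hS' hp⟩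

theorem LetterAccepts.returning {q a γ} (h : M.LetterAccepts q a γ) :
    M.returning.LetterAccepts (q, false) a γ := by
  cases h with
  | push ha hS => exact .push ha (congrArg (Outcome.map _) hS)
  | pop ha hS => exact .pop ha (congrArg (Outcome.map _) hS)
  | neutral ha hS => exact .neutral ha (congrArg (Outcome.map _) hS)

theorem LetterAccepts.of_returning {q a γ} (h : M.returning.LetterAccepts (q, false) a γ) :
    M.LetterAccepts q a γ := by
  cases h with
  | push ha hS => exact .push ha (Outcome.map_eq_accept hS)
  | pop ha hS => exact .pop ha (Outcome.map_eq_accept hS)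
  | neutral ha hS => exact .neutral ha (Outcome.map_eq_accept hS)

theorem accept_returning {C : M.Config} (h : ReflTransGen M.Step C .accept) :
    ∀ q w γ, C = .run q w γ →
      ReflTransGen M.returning.NRStep (.run [] (q, false) w γ) .accept := by
  induction h using ReflTransGen.head_induction_on with
  | refl => rintro q w γ ⟨⟩
  | head h _ ih =>
    rintro q w γ rfl
    cases h with
    | @letter q x a y γ q' γ' hx ha h =>
      refine .head (.letter (by simpa [NIDPDAwtl.returning] using hx)
        (by simpa [NIDPDAwtl.returning] using ha) h.returning) (.head ?_ (ih _ _ _ rfl))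
      have hτ : M.returning.τ (q', true) = Set.univ := rfl
      exact .endmarker (M := M.returning) (u := [] ++ x) (x := y) (q := (q', true)) (fun c _ => hτ ▸ Set.mem_univ c) rfl rfl
    | letterAccept hx ha h =>
      exact .single (.letterAccept (by simpa [NIDPDAwtl.returning] using hx)
        (by simpa [NIDPDAwtl.returning] using ha) h.returning)
    | endmarker hx hS h =>
      exact .head (.endmarker (by simpa [NIDPDAwtl.returning] using hx)
        (congrArg (Outcome.map _) hS) (Set.mem_image_of_mem _ h)) (ih _ _ _ rfl)
    | endmarkerAccept hx hS =>
      exact .single (.endmarkerAccept (by simpa [NIDPDAwtl.returning] using hx)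
        (congrArg (Outcome.map _) hS))

/-- With flag `true` the next step restores the whole remaining word `u ++ w`. With flag `false` the
head is at the left end, so `u` is empty. -/
theorem accept_of_returning {C : M.returning.NRConfig}
    (h : ReflTransGen M.returning.NRStep C .accept) : ∀ u q b w γ, C = .run u (q, b) w γ →
      (b = true ∨ u = []) → ReflTransGen M.Step (.run q (u ++ w) γ) .accept := by
  induction h using ReflTransGen.head_induction_on with
  | refl => rintro u q b w γ ⟨⟩
  | head h _ ih =>
    rintro u q b w γ rfl hb
    cases b with
    | true =>
      cases h with
      | letter _ ha => simp [returning] at ha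
      | letterAccept _ ha => simp [returning] at ha
      | endmarker hx hS h =>
        cases hS
        cases h
        exact ih [] q false _ γ rfl (.inr rfl)
      | endmarkerAccept _ hS => cases hS
    | false =>
      obtain rfl : u = [] := by simpa using hb
      cases h with
      | letter hx ha h =>
        obtain ⟨p, rfl, h'⟩ := h.of_returning
        exact .head (.letter (by simpa [returning] using hx) (by simpa [returning] using ha) h')
          (ih _ _ _ _ _ rfl (.inl rfl))
      | letterAccept hx ha h =>
        exact .single (.letterAccept (by simpa [returning] using hx)
          (by simpa [returning] using ha) h.of_returning)
      | endmarker hx hS h =>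
        obtain ⟨S, hS', rfl⟩ := Outcome.map_eq_goto hS
        obtain ⟨p, hp, rfl⟩ := h
        exact .head (.endmarker (by simpa [returning] using hx) hS' hp)
          (ih _ _ _ _ _ rfl (.inr rfl))
      | endmarkerAccept hx hS =>
        exact .single (.endmarkerAccept (by simpa [returning] using hx) (Outcome.map_eq_accept hS))

theorem nrLanguage_returning : M.returning.nrLanguage = M.language :=
  Set.ext fun w => ⟨fun h => accept_of_returning h [] M.start false w [] rfl (.inr rfl),
    fun h => accept_returning h M.start w [] rfl⟩

end NIDPDAwtl

theorem didpdawtl_subset_nrDIDPDAwtl (A : Type) (s : Signature A) :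
    DIDPDAwtl A s ⊆ nrDIDPDAwtl A s := by
  rintro _ ⟨M, hM, hs, rfl⟩
  exact ⟨M.returning, hM.returning, hs, NIDPDAwtl.nrLanguage_returning⟩

/-! ### The witness languages -/

open Relation List

instance : Finite Letter :=
  Finite.of_injective (fun c : Letter => match c with | .a => (0 : Fin 3) | .b => 1 | .hash => 2)
    (by intro c d; cases c <;> cases d <;> simp)

/-- Whether a letter is `a`. -/
def Letter.isA : Letter → Bool
  | .a => true
  | _ => false

/-- The word without the letters `a`. -/
def dropA (w : List Letter) : List Letter := w.filter fun c => !c.isA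

/-- The number of letters `a`. -/
def countA (w : List Letter) : ℕ := w.countP Letter.isA

@[simp] theorem dropA_nil : dropA [] = [] := rfl
@[simp] theorem dropA_a (w) : dropA (.a :: w) = dropA w := rfl
@[simp] theorem dropA_b (w) : dropA (.b :: w) = .b :: dropA w := rfl
@[simp] theorem dropA_hash (w) : dropA (.hash :: w) = .hash :: dropA w := rfl
@[simp] theorem dropA_append (v w) : dropA (v ++ w) = dropA v ++ dropA w := filter_append _ _
@[simp] theorem countA_nil : countA [] = 0 := rfl
@[simp] theorem countA_a (w) : countA (.a :: w) = countA w + 1 :=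
  countP_cons_of_pos rfl
@[simp] theorem countA_b (w) : countA (.b :: w) = countA w := by simp [countA, Letter.isA]
@[simp] theorem countA_hash (w) : countA (.hash :: w) = countA w := by simp [countA, Letter.isA]
@[simp] theorem countA_append (v w) : countA (v ++ w) = countA v + countA w := countP_append

theorem Shuffle.dropA_eq {u v w : List Letter} (h : Shuffle u v w) (hu : .a ∉ u)
    (hv : ∀ c ∈ v, c = .a) : dropA w = u ∧ countA w = v.length := by
  induction h with
  | nil => simp
  | @left c u v w h ih =>
    have := ih (by simp_all) hv
    cases c <;> simp_all
  | @right c u v w h ih =>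
    have := ih hu fun d hd => hv d (by simp [hd])
    obtain rfl : c = .a := hv c (by simp)
    simp_all

theorem shuffle_dropA : ∀ w, Shuffle (dropA w) (replicate (countA w) .a) w
  | [] => .nil
  | .a :: w => by rw [dropA_a, countA_a, replicate_succ]; exact .right (shuffle_dropA w)
  | .b :: w => by rw [dropA_b, countA_b]; exact .left (shuffle_dropA w)
  | .hash :: w => by rw [dropA_hash, countA_hash]; exact .left (shuffle_dropA w)

/-- Membership in `langL1` and `langL2` thus depends only on the word without its `a`'s and on their
number. -/
theorem shuffle_iff {u w : List Letter} {n : ℕ} (hu : .a ∉ u) :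
    Shuffle u (replicate n .a) w ↔ dropA w = u ∧ countA w = n := by
  constructor
  · intro h
    simpa using h.dropA_eq hu (fun c hc => eq_of_mem_replicate hc)
  · rintro ⟨rfl, rfl⟩
    exact shuffle_dropA w

theorem mem_langL1 {w : List Letter} : w ∈ langL1 ↔ ∃ m n : ℕ, 1 ≤ m ∧ 1 ≤ n ∧
    dropA w = replicate n .b ++ .hash :: replicate m .b ∧ countA w = n := by
  change (∃ m n : ℕ, 1 ≤ m ∧ 1 ≤ n ∧ Shuffle _ _ w) ↔ _
  refine exists_congr fun m => exists_congr fun n => and_congr_right fun _ => and_congr_right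
    fun _ => shuffle_iff (by simp [mem_replicate])

theorem mem_langL2 {w : List Letter} : w ∈ langL2 ↔ ∃ m n : ℕ, 1 ≤ m ∧ 1 ≤ n ∧
    dropA w = replicate m .b ++ .hash :: replicate n .b ∧ countA w = n := by
  change (∃ m n : ℕ, 1 ≤ m ∧ 1 ≤ n ∧ Shuffle _ _ w) ↔ _
  refine exists_congr fun m => exists_congr fun n => and_congr_right fun _ => and_congr_right
    fun _ => shuffle_iff (by simp [mem_replicate])

/-! ### Automata for the witness languages -/

/-- The states of the two automata for `langL1` and `langL2`. -/
inductive Phase where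
  | first
  | second
  | third
  | fourth

instance : Finite Phase :=
  Finite.of_injective (fun c : Phase => match c with
    | .first => (0 : Fin 4) | .second => 1 | .third => 2 | .fourth => 3)
    (by intro c d; cases c <;> cases d <;> simp)

/-- An automaton for `langL1`: it pushes a symbol for each `a`, compares the height of the store
with the length of the first block of `b`'s, and checks that the second block is not empty. -/
def automaton₁ : NIDPDAwtl Letter where
  State := Phase
  Stack := Unit
  finiteState := inferInstance
  finiteStack := inferInstance
  sig := Letter.sig
  start := .first
  τ
    | .first => {.b, .hash}
    | _ => ∅
  δD
    | .first, _, _ => .goto {(.first, ())}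
    | _, _, _ => .goto ∅
  δR
    | .second, _, some _ => .goto {.second}
    | .third, _, _ => .goto {.fourth}
    | .fourth, _, _ => .goto {.fourth}
    | _, _, _ => .goto ∅
  δN
    | .first, none, some _ => .goto {.second}
    | .second, some _, none => .goto {.third}
    | .fourth, none, _ => .accept
    | _, _, _ => .goto ∅

/-- An automaton for `langL2`: it deletes the first block of `b`'s and the `#`, pushes a symbol for
each `a`, and compares the height of the store with the length of the second block of `b`'s. -/
def automaton₂ : NIDPDAwtl Letter where
  State := Phase
  Stack := Unit
  finiteState := inferInstance
  finiteStack := inferInstance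
  sig := Letter.sig
  start := .first
  τ
    | .first => {.a}
    | .second => {.a}
    | .third => {.b}
    | .fourth => ∅
  δD
    | .third, _, _ => .goto {(.third, ())}
    | _, _, _ => .goto ∅
  δR
    | .first, _, _ => .goto {.second}
    | .second, _, _ => .goto {.second}
    | .fourth, _, some _ => .goto {.fourth}
    | _, _, _ => .goto ∅
  δN
    | .second, some _, _ => .goto {.third}
    | .third, none, some _ => .goto {.fourth}
    | .fourth, none, none => .accept
    | _, _, _ => .goto ∅

theorem automaton₁_isDeterministic : automaton₁.IsDeterministic := by
  refine ⟨fun q c z _ => ?_, fun q c z _ => ?_, fun q c z _ => ?_, fun q z => ?_⟩ <;>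
  cases q <;> cases z <;> simp [automaton₁, Outcome.AtMostOne]

theorem automaton₂_isDeterministic : automaton₂.IsDeterministic := by
  refine ⟨fun q c z _ => ?_, fun q c z _ => ?_, fun q c z _ => ?_, fun q z => ?_⟩ <;>
  cases q <;> cases z <;> simp [automaton₂, Outcome.AtMostOne]

theorem dropA_eq_nil {x : List Letter} (hx : ∀ c ∈ x, c ∈ ({.a} : Set Letter)) : dropA x = [] := by
  induction x with
  | nil => rfl
  | cons c x ih =>
    obtain rfl : c = .a := hx c (by simp)
    simpa using ih fun d hd => hx d (by simp [hd])

theorem countA_eq_zero {x : List Letter} (hx : .a ∉ x) : countA x = 0 ∧ dropA x = x := by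
  induction x with
  | nil => simp
  | cons c x ih => cases c <;> simp_all

/-- The configurations from which `automaton₁` accepts. -/
def Good₁ : automaton₁.Config → Prop
  | .run .first w γ => ∃ k m : ℕ, 1 ≤ k ∧ 1 ≤ m ∧
      dropA w = replicate k .b ++ .hash :: replicate m .b ∧ γ.length + countA w = k
  | .run .second w γ => ∃ m : ℕ, 1 ≤ m ∧
      w = replicate γ.length .b ++ .hash :: replicate m .b
  | .run .third w _ => ∃ m : ℕ, 1 ≤ m ∧ w = replicate m .b
  | .run .fourth w _ => ∃ m : ℕ, w = replicate m .b
  | .accept => True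

/-- Goodness is carried backwards from `accept`, so every configuration with an accepting
computation is good. In the first phase, store height plus remaining `a`'s is constant. -/
theorem good₁_of_step {C D} (h : automaton₁.Step C D) (hD : Good₁ D) : Good₁ C := by
  cases h with
  | @letter q x c y γ q' γ' hx hc h =>
    cases q with
    | first =>
      cases h with
      | push _ hS h =>
        cases hS; cases h
        cases c with
        | a =>
          obtain ⟨k, m, hk, hm, h1, h2⟩ := hD
          have h2 : γ.length + 1 + countA (x ++ y) = k := h2
          exact ⟨k, m, hk, hm, by simpa using h1, by simp at h2 ⊢; omega⟩
        | b => simp [automaton₁] at hc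
        | hash => simp [automaton₁] at hc
      | pop _ hS h => cases hS; cases h
      | neutral _ hS h => cases hS; cases h
    | second =>
      obtain rfl : x = [] := eq_nil_iff_forall_not_mem.2 hx
      cases h with
      | push _ hS h => cases hS; cases h
      | pop hs hS h =>
        cases c <;> cases hs
        cases γ with
        | nil => cases hS; cases h
        | cons z γ =>
          cases hS; cases h
          obtain ⟨m, hm, h⟩ := hD
          exact ⟨m, hm, by simpa [replicate_succ] using h⟩
      | neutral hs hS h =>
        cases c <;> cases hs
        cases γ with
        | cons z γ => cases hS; cases h
        | nil =>
          cases hS; cases h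
          obtain ⟨m, hm, h⟩ := hD
          exact ⟨m, hm, by simpa using h⟩
    | third =>
      obtain rfl : x = [] := eq_nil_iff_forall_not_mem.2 hx
      cases h with
      | push _ hS h => cases hS; cases h
      | pop hs hS h =>
        cases c <;> cases hs
        cases hS; cases h
        obtain ⟨m, h⟩ := hD
        exact ⟨m + 1, by omega, by simpa [replicate_succ] using h⟩
      | neutral _ hS h => cases hS; cases h
    | fourth =>
      obtain rfl : x = [] := eq_nil_iff_forall_not_mem.2 hx
      cases h with
      | push _ hS h => cases hS; cases h
      | pop hs hS h =>
        cases c <;> cases hs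
        cases hS; cases h
        obtain ⟨m, h⟩ := hD
        exact ⟨m + 1, by simpa [replicate_succ] using h⟩
      | neutral _ hS h => cases hS; cases h
  | @letterAccept q x c y γ hx hc h =>
    cases q <;> cases γ <;> cases h <;> rename_i h <;> cases h
  | @endmarker q x γ q' S hx hS h =>
    cases q with
    | first =>
      cases γ with
      | nil => cases hS; cases h
      | cons z γ =>
        cases hS; cases h
        obtain ⟨m, hm, h⟩ := hD
        obtain ⟨h1, h2⟩ := countA_eq_zero (x := x) (fun ha => by simpa [automaton₁] using hx _ ha)
        exact ⟨_, m, by simp, hm, h2.trans h, by omega⟩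
    | second => cases γ <;> cases hS <;> cases h
    | third => cases hS; cases h
    | fourth => cases hS
  | @endmarkerAccept q x γ hx hS =>
    cases q with
    | first => cases γ <;> cases hS
    | second => cases γ <;> cases hS
    | third => cases hS
    | fourth => exact ⟨0, eq_nil_iff_forall_not_mem.2 hx⟩

/-- The configurations from which `automaton₂` accepts. -/
def Good₂ : automaton₂.Config → Prop
  | .run .first w γ => γ = [] → ∃ m n : ℕ, 1 ≤ m ∧ 1 ≤ n ∧
      dropA w = replicate m .b ++ .hash :: replicate n .b ∧ countA w = n
  | .run .second w γ => γ = [] → ∃ m n : ℕ, 1 ≤ n ∧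
      dropA w = replicate m .b ++ .hash :: replicate n .b ∧ countA w = n
  | .run .third w γ => ∃ n : ℕ, 1 ≤ n ∧ dropA w = replicate n .b ∧ γ.length + countA w = n
  | .run .fourth w γ => w = replicate γ.length .b
  | .accept => True

/-- Symbols already in the store would spoil the count in the third phase. Hence the first two
clauses of `Good₂` concern only the empty store, which popping leaves empty. -/
theorem good₂_of_step {C D} (h : automaton₂.Step C D) (hD : Good₂ D) : Good₂ C := by
  cases h with
  | @letter q x c y γ q' γ' hx hc h =>
    cases q with
    | first =>
      have hx' := dropA_eq_nil hx
      cases h with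
      | push _ hS h => cases hS; cases h
      | pop hs hS h =>
        cases c <;> cases hs
        cases hS; cases h
        rintro rfl
        obtain ⟨m, n, hn, h1, h2⟩ := hD rfl
        exact ⟨m + 1, n, by omega, hn, by simp_all [replicate_succ], by simpa using h2⟩
      | neutral _ hS h => cases hS; cases h
    | second =>
      have hx' := dropA_eq_nil hx
      cases h with
      | push _ hS h => cases hS; cases h
      | pop hs hS h =>
        cases c <;> cases hs
        cases hS; cases h
        rintro rfl
        obtain ⟨m, n, hn, h1, h2⟩ := hD rfl
        exact ⟨m + 1, n, hn, by simp_all [replicate_succ], by simpa using h2⟩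
      | neutral hs hS h =>
        cases c <;> cases hs
        cases hS; cases h
        rintro rfl
        obtain ⟨n, hn, h1, h2⟩ := hD
        exact ⟨0, n, hn, by simp_all, by simpa using h2⟩
    | third =>
      cases h with
      | push _ hS h =>
        cases hS; cases h
        cases c with
        | a =>
          obtain ⟨n, hn, h1, h2⟩ := hD
          have h2 : γ.length + 1 + countA (x ++ y) = n := h2
          exact ⟨n, hn, by simpa using h1, by simp at h2 ⊢; omega⟩
        | b => simp [automaton₂] at hc
        | hash => contradiction
      | pop _ hS h => cases hS; cases h
      | neutral _ hS h => cases hS; cases h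
    | fourth =>
      obtain rfl : x = [] := eq_nil_iff_forall_not_mem.2 hx
      cases h with
      | push _ hS h => cases hS; cases h
      | pop hs hS h =>
        cases c <;> cases hs
        cases γ with
        | nil => cases hS; cases h
        | cons z γ =>
          cases hS; cases h
          have hD : y = replicate γ.length .b := hD
          simp [Good₂, hD, replicate_succ]
      | neutral _ hS h => cases γ <;> cases hS <;> cases h
  | @letterAccept q x c y γ hx hc h =>
    cases q <;> cases γ <;> cases h <;> rename_i h <;> cases h
  | @endmarker q x γ q' S hx hS h =>
    cases q with
    | first => cases hS; cases h
    | second => cases hS; cases h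
    | third =>
      cases γ with
      | nil => cases hS; cases h
      | cons z γ =>
        cases hS; cases h
        obtain ⟨h1, h2⟩ := countA_eq_zero (x := x) (fun ha => by simpa [automaton₂] using hx _ ha)
        exact ⟨_, by simp, h2.trans hD, by omega⟩
    | fourth =>
      cases γ <;> cases hS
      cases h
  | @endmarkerAccept q x γ hx hS =>
    cases q with
    | first => cases hS
    | second => cases hS
    | third => cases γ <;> cases hS
    | fourth =>
      cases γ with
      | nil => exact eq_nil_iff_forall_not_mem.2 hx
      | cons => cases hS

theorem accept_of_good {M : NIDPDAwtl Letter} {Good : M.Config → Prop} (hacc : Good .accept)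
    (hstep : ∀ C D, M.Step C D → Good D → Good C) {C} (h : ReflTransGen M.Step C .accept) :
    Good C := by
  induction h using ReflTransGen.head_induction_on with
  | refl => exact hacc
  | head h _ ih => exact hstep _ _ h ih

theorem split_countA {w : List Letter} {n : ℕ} (h : countA w = n + 1) :
    ∃ x y, w = x ++ .a :: y ∧ (∀ c ∈ x, c ∈ ({.b, .hash} : Set Letter)) ∧
      dropA (x ++ y) = dropA w ∧ countA (x ++ y) = n := by
  have ha : .a ∈ w := by
    by_contra ha
    have := (countA_eq_zero ha).1
    omega
  obtain ⟨x, y, rfl, hx⟩ := eq_append_cons_of_mem ha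
  refine ⟨x, y, rfl, fun c hc => ?_, by simp, by simp at h ⊢; omega⟩
  cases c <;> simp_all

theorem split_dropA {w u : List Letter} {c : Letter} (h : dropA w = c :: u) :
    ∃ x y, w = x ++ c :: y ∧ (∀ d ∈ x, d ∈ ({.a} : Set Letter)) ∧ dropA (x ++ y) = u ∧
      countA (x ++ y) = countA w := by
  induction w with
  | nil => cases h
  | cons d w ih =>
    cases d with
    | a =>
      obtain ⟨x, y, rfl, hx, h1, h2⟩ := ih h
      exact ⟨.a :: x, y, rfl, by simpa using hx, by simpa using h1, by simpa using h2⟩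
    | b => rw [dropA_b] at h; cases h; exact ⟨[], w, rfl, by simp, by simp, by simp⟩
    | hash => rw [dropA_hash] at h; cases h; exact ⟨[], w, rfl, by simp, by simp, by simp⟩

theorem accept₁_fourth (m : ℕ) (γ) :
    ReflTransGen automaton₁.Step (.run .fourth (replicate m .b) γ) .accept := by
  induction m generalizing γ with
  | zero => exact .single (.endmarkerAccept (by simp) rfl)
  | succ m ih =>
    exact .head (.letter (x := []) (by simp) (Set.notMem_empty _) (.pop rfl rfl rfl)) (ih _)

theorem accept₁_third (m : ℕ) (γ) :
    ReflTransGen automaton₁.Step (.run .third (replicate (m + 1) .b) γ) .accept :=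
  .head (.letter (x := []) (by simp) (Set.notMem_empty _) (.pop rfl rfl rfl)) (accept₁_fourth m _)

theorem accept₁_second (m : ℕ) (γ : List Unit) :
    ReflTransGen automaton₁.Step
      (.run .second (replicate γ.length .b ++ .hash :: replicate (m + 1) .b) γ) .accept := by
  induction γ with
  | nil =>
    exact .head (.letter (x := []) (by simp) (Set.notMem_empty _) (.neutral rfl rfl rfl))
      (accept₁_third m _)
  | cons z γ ih =>
    exact .head (.letter (x := []) (by simp) (Set.notMem_empty _) (.pop rfl rfl rfl)) ih

theorem accept₁_first (m n : ℕ) (γ : List Unit) (w) (hn : 1 ≤ γ.length + n) (hw : countA w = n)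
    (h : dropA w = replicate (γ.length + n) .b ++ .hash :: replicate (m + 1) .b) :
    ReflTransGen automaton₁.Step (.run .first w γ) .accept := by
  induction n generalizing γ w with
  | zero =>
    have ha : .a ∉ w := fun ha => by
      obtain ⟨x, y, rfl, -⟩ := eq_append_cons_of_mem ha
      simp at hw
    rw [(countA_eq_zero ha).2] at h
    subst h
    obtain _ | ⟨z, γ⟩ := γ
    · simp at hn
    · exact .head (.endmarker (fun c hc => by cases c <;> simp_all [automaton₁]) rfl rfl)
        (accept₁_second m (z :: γ))
  | succ n ih =>
    obtain ⟨x, y, rfl, hx, h1, h2⟩ := split_countA hw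
    have e : γ.length + (n + 1) = (() :: γ).length + n := by rw [length_cons]; omega
    refine .head (.letter hx (by simp [automaton₁]) (.push rfl rfl rfl)) (ih _ _ ?_ h2 ?_)
    · exact hn.trans_eq e
    · exact h1.trans (e ▸ h)

theorem automaton₁_language : automaton₁.language = langL1 := by
  ext w
  rw [mem_langL1]
  constructor
  · intro h
    obtain ⟨k, m, hk, hm, h1, h2⟩ := accept_of_good (Good := Good₁) trivial
      (fun _ _ => good₁_of_step) h
    exact ⟨m, k, hm, hk, h1, by simpa using h2⟩
  · rintro ⟨m, n, hm, hn, h1, h2⟩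
    obtain ⟨m, rfl⟩ := Nat.exists_eq_add_of_le' hm
    exact accept₁_first m n [] w (by simpa using hn) h2 (by simpa using h1)

theorem accept₂_fourth (γ : List Unit) :
    ReflTransGen automaton₂.Step (.run .fourth (replicate γ.length .b) γ) .accept := by
  induction γ with
  | nil => exact .single (.endmarkerAccept (by simp) rfl)
  | cons z γ ih =>
    exact .head (.letter (x := []) (by simp) (Set.notMem_empty _) (.pop rfl rfl rfl)) ih

theorem accept₂_third (n : ℕ) (γ : List Unit) (w) (hn : 1 ≤ γ.length + n) (hw : countA w = n)
    (h : dropA w = replicate (γ.length + n) .b) :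
    ReflTransGen automaton₂.Step (.run .third w γ) .accept := by
  induction n generalizing γ w with
  | zero =>
    have ha : .a ∉ w := fun ha => by
      obtain ⟨x, y, rfl, -⟩ := eq_append_cons_of_mem ha
      simp at hw
    rw [(countA_eq_zero ha).2] at h
    subst h
    obtain _ | ⟨z, γ⟩ := γ
    · simp at hn
    · exact .head (.endmarker (fun c hc => eq_of_mem_replicate hc) rfl rfl)
        (accept₂_fourth (z :: γ))
  | succ n ih =>
    obtain ⟨x, y, rfl, hx, h1, h2⟩ := split_countA hw
    have e : γ.length + (n + 1) = (() :: γ).length + n := by rw [length_cons]; omega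
    refine .head (.letter (fun c hc => ?_) (by simp [automaton₂]) (.push rfl rfl rfl))
      (ih _ _ ?_ h2 ?_)
    · rcases hx c hc with rfl | rfl
      · rfl
      -- In the third phase only `b` is translucent, so a `#` before the next `a` has to be
      -- excluded; the assumption on `dropA` does this.
      · have : Letter.hash ∈ dropA (x ++ .a :: y) := by simp [dropA, Letter.isA, hc]
        rw [h] at this
        simp at this
    · exact hn.trans_eq e
    · exact h1.trans (e ▸ h)

theorem accept₂_second (m n : ℕ) (w) (hn : 1 ≤ n) (hw : countA w = n)
    (h : dropA w = replicate m .b ++ .hash :: replicate n .b) :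
    ReflTransGen automaton₂.Step (.run .second w []) .accept := by
  induction m generalizing w with
  | zero =>
    obtain ⟨x, y, rfl, hx, h1, h2⟩ := split_dropA h
    exact .head (.letter hx (by simp [automaton₂]) (.neutral rfl rfl rfl))
      (accept₂_third n [] _ (by simpa using hn) (h2.trans hw) (by simpa using h1))
  | succ m ih =>
    obtain ⟨x, y, rfl, hx, h1, h2⟩ := split_dropA h
    exact .head (.letter hx (by simp [automaton₂]) (.pop rfl rfl rfl)) (ih _ (h2.trans hw) h1)

theorem automaton₂_language : automaton₂.language = langL2 := by
  ext w
  rw [mem_langL2]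
  constructor
  · intro h
    obtain ⟨m, n, hm, hn, h1, h2⟩ := accept_of_good (Good := Good₂) trivial
      (fun _ _ => good₂_of_step) h rfl
    exact ⟨m, n, hm, hn, h1, h2⟩
  · rintro ⟨m, n, hm, hn, h1, h2⟩
    obtain ⟨m, rfl⟩ := Nat.exists_eq_add_of_le' hm
    obtain ⟨x, y, rfl, hx, h3, h4⟩ := split_dropA h1
    exact .head (.letter hx (by simp [automaton₂]) (.pop rfl rfl rfl))
      (accept₂_second m n _ hn (h4.trans h2) h3)

/-! ### Non-closure of the two families -/

theorem langL1_mem : langL1 ∈ DIDPDAwtl Letter Letter.sig :=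
  ⟨automaton₁, automaton₁_isDeterministic, rfl, automaton₁_language⟩

theorem langL2_mem : langL2 ∈ DIDPDAwtl Letter Letter.sig :=
  ⟨automaton₂, automaton₂_isDeterministic, rfl, automaton₂_language⟩

theorem replicate_append_hash_inj {i j m n : ℕ}
    (h : List.replicate i Letter.b ++ .hash :: List.replicate j .b =
      List.replicate m .b ++ .hash :: List.replicate n .b) : i = m ∧ j = n := by
  obtain ⟨h1, -, h2⟩ := append_cons_unique (t := {Letter.b}) (by simp) (by simp)
    (fun c hc => List.eq_of_mem_replicate hc) (fun c hc => List.eq_of_mem_replicate hc) h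
  exact ⟨by simpa using congrArg List.length h1, by simpa using congrArg List.length h2⟩

theorem dropA_blockWord (n i j : ℕ) : dropA (blockWord ![n, i, 1, j]) =
    List.replicate i .b ++ .hash :: List.replicate j .b ∧ countA (blockWord ![n, i, 1, j]) = n := by
  simp [blockWord, blocks, List.finRange_succ, blockLetter, dropA, countA, Letter.isA,
    List.countP_replicate]

theorem blockWord_mem_langL1 {n i j : ℕ} (hi : 1 ≤ i) (hj : 1 ≤ j) :
    blockWord ![n, i, 1, j] ∈ langL1 ↔ n = i := by
  rw [mem_langL1, (dropA_blockWord n i j).1, (dropA_blockWord n i j).2]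
  constructor
  · rintro ⟨m, k, -, -, h, rfl⟩
    exact (replicate_append_hash_inj h).1.symm
  · rintro rfl
    exact ⟨j, n, hj, hi, rfl, rfl⟩

theorem blockWord_mem_langL2 {n i j : ℕ} (hi : 1 ≤ i) (hj : 1 ≤ j) :
    blockWord ![n, i, 1, j] ∈ langL2 ↔ n = j := by
  rw [mem_langL2, (dropA_blockWord n i j).1, (dropA_blockWord n i j).2]
  constructor
  · rintro ⟨m, k, -, -, h, rfl⟩
    exact (replicate_append_hash_inj h).2.symm
  · rintro rfl
    exact ⟨i, n, hi, hj, rfl, rfl⟩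

theorem union_notMem (s : Signature Letter) :
    unionOp Letter langL1 langL2 ∉ nrDIDPDAwtl Letter s := by
  rintro ⟨M, hM, -, hL⟩
  refine hM.not_or fun n i j _ hi hj => ?_
  rw [hL, ← blockWord_mem_langL1 hi hj, ← blockWord_mem_langL2 (n := n) hi hj]
  rfl

theorem inter_notMem (s : Signature Letter) :
    interOp Letter langL1 langL2 ∉ nrDIDPDAwtl Letter s := by
  rintro ⟨M, hM, -, hL⟩
  refine hM.not_and fun n i j _ hi hj => ?_
  rw [hL, ← blockWord_mem_langL1 hi hj, ← blockWord_mem_langL2 (n := n) hi hj]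
  rfl

/-- Any family between the returning and the non-returning one is treated alike: it contains both
witnesses but not the result of the operation. -/
theorem not_closedUnderOnSameSignature {F : (A : Type) → Signature A → Set (Language A)}
    {op : (A : Type) → Language A → Language A → Language A}
    (hF : ∀ A s, DIDPDAwtl A s ⊆ F A s) (hF' : ∀ A s, F A s ⊆ nrDIDPDAwtl A s)
    (h : ∀ s, op Letter langL1 langL2 ∉ nrDIDPDAwtl Letter s) :
    ¬ ClosedUnderOnSameSignature F op := fun hcl => by
  obtain ⟨s, hs⟩ := hcl Letter Letter.sig _ _ (hF _ _ langL1_mem) (hF _ _ langL2_mem)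
  exact h s (hF' _ _ hs)

theorem ClosedUnder.onSameSignature {F : (A : Type) → Signature A → Set (Language A)}
    {op : (A : Type) → Language A → Language A → Language A} (h : ClosedUnder F op) :
    ClosedUnderOnSameSignature F op :=
  fun A _ s _ _ h₁ h₂ => h A _ _ ⟨s, h₁⟩ ⟨s, h₂⟩

end TranslucentPDA

theorem proposition7 :
    -- both witness languages are accepted by a DIDPDAwtl with the same signature
    TranslucentPDA.langL1 ∈ TranslucentPDA.DIDPDAwtl TranslucentPDA.Letter
      TranslucentPDA.Letter.sig ∧
    TranslucentPDA.langL2 ∈ TranslucentPDA.DIDPDAwtl TranslucentPDA.Letter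
      TranslucentPDA.Letter.sig ∧
    -- their union is not accepted by any nrDIDPDAwtl, whatever its signature
    (∀ s, TranslucentPDA.unionOp TranslucentPDA.Letter TranslucentPDA.langL1
      TranslucentPDA.langL2 ∉ TranslucentPDA.nrDIDPDAwtl TranslucentPDA.Letter s) ∧
    -- neither family is closed under union or under intersection
    ¬ TranslucentPDA.ClosedUnder TranslucentPDA.nrDIDPDAwtl TranslucentPDA.unionOp ∧
    ¬ TranslucentPDA.ClosedUnder TranslucentPDA.nrDIDPDAwtl TranslucentPDA.interOp ∧
    ¬ TranslucentPDA.ClosedUnder TranslucentPDA.DIDPDAwtl TranslucentPDA.unionOp ∧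
    ¬ TranslucentPDA.ClosedUnder TranslucentPDA.DIDPDAwtl TranslucentPDA.interOp ∧
    -- not even for automata with identical signatures
    ¬ TranslucentPDA.ClosedUnderOnSameSignature TranslucentPDA.nrDIDPDAwtl
      TranslucentPDA.unionOp ∧
    ¬ TranslucentPDA.ClosedUnderOnSameSignature TranslucentPDA.nrDIDPDAwtl
      TranslucentPDA.interOp ∧
    ¬ TranslucentPDA.ClosedUnderOnSameSignature TranslucentPDA.DIDPDAwtl
      TranslucentPDA.unionOp ∧
    ¬ TranslucentPDA.ClosedUnderOnSameSignature TranslucentPDA.DIDPDAwtl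
      TranslucentPDA.interOp := by 
  have hsub := TranslucentPDA.didpdawtl_subset_nrDIDPDAwtl
  have hU := TranslucentPDA.union_notMem
  have hI := TranslucentPDA.inter_notMem
  have h₁ := TranslucentPDA.not_closedUnderOnSameSignature hsub (fun _ _ => subset_rfl) hU
  have h₂ := TranslucentPDA.not_closedUnderOnSameSignature hsub (fun _ _ => subset_rfl) hI
  have h₃ := TranslucentPDA.not_closedUnderOnSameSignature (fun _ _ => subset_rfl) hsub hU
  have h₄ := TranslucentPDA.not_closedUnderOnSameSignature (fun _ _ => subset_rfl) hsub hI
  exact ⟨TranslucentPDA.langL1_mem, TranslucentPDA.langL2_mem, hU,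
    fun h => h₁ h.onSameSignature, fun h => h₂ h.onSameSignature,
    fun h => h₃ h.onSameSignature, fun h => h₄ h.onSameSignature, h₁, h₂, h₃, h₄⟩
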